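/- **Network and cost.** Let $G=(V,E)$ be a symmetric tree topology: a finite tree, each edge of which stands for two directed links, one in each direction, with the same bandwidth $w_e\in[0,\infty]$; $V_C\subseteq V$ is the set of compute nodes. A set $R$ of $N$ elements of a totally ordered domain is distributed over the compute nodes without duplication, with $N_v$ elements on $v\in V_C$; the numbers $N_v$ are known to all nodes. An algorithm works in synchronous rounds; in each round every compute node sends to each other compute node a set of elements that it stores, along the unique path of the tree, the choice depending on coin tosses, on its initial data and on what it has received so far. If $Y_i(e)$ is the set of elements routed through the directed link $e$ in round $i$, the (tuple) cost of the algorithm is $\sum_i\max_{e}|Y_i(e)|/w_e$. An ordering $v_1,v_2,\dots$ of compute nodes is that of a left-to-right traversal of $G$ for some choice of the root. The algorithm *sorts* $R$ along such an ordering if in the end every element of $R$ is returned by exactly one node, every node returns its elements in increasing order, and all elements returned by an earlier node are smaller than those returned by a later one. **Optimal cost.** Put $C_{LB}=\max_{e\in E}\frac1{w_e}\min\{\sum_{v\in V_e^-}N_v,\sum_{v\in V_e^+}N_v\}$, where $V_e^-,V_e^+$ are the sets of compute nodes on the two sides of $e$. Let $\mathrm{OPT}$ be the infimum of all $K$ such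 that some randomized algorithm (which may depend on $G$, the bandwidths and the numbers $N_v$) sorts every set of $N$ elements of the domain, placed in any way with $N_v$ elements on each $v$, along some fixed left-to-right traversal, with cost at most $K$ and with probability at least $1-\frac1N$. **Weighted TeraSort (wTS).** Fix a root and a left-to-right traversal. A compute node $v$ is *heavy* if $N_v\ge\frac{N}{2|V_C|}$ and *light* otherwise; let $v_1,\dots,v_k$ be the heavy nodes from left to right, and let $\rho=4\frac{|V_C|}{N}\ln(|V_C|\cdot N)$. - *Round 1.* Each light node $u$ sends $N_u^i$ of its elements (taken in increasing order) to $v_i$, $i=1,\dots,k$. Here the $N_u^i$ are computed in turn, starting from $\Delta=0$: for $x=\frac{N_{v_i}}{\sum_j N_{v_j}}N_u$, if $\Delta\ge x-\lfloor x\rfloor$ then $N_u^i=\lfloor x\rfloor$ and $\Delta$ decreases by $x-\lfloor x\rfloor$; otherwise $N_u^i=\lfloor x\rfloor+1$ and $\Delta$ increases by $1-(x-\lfloor x\rfloor)$. Let $M_j$ be the number of elements on $v_j$ after this round. - *Round 2.* Each heavy node samples each of its elements independently with probability $\rho$ and sends the sampled elements to $v_1$. Let $s$ be the number of samples. - *Round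 3.* Let $t_i$ be the $i\lceil s/|V_C|\rceil$-th smallest sample, with $t_i=+\infty$ if $i\ge|V_C|$ or there is no such sample; let $c_j=\lceil\frac{|V_C|}{N}M_j\rceil$, $b_0=-\infty$, $b_k=+\infty$ and $b_i=t_{c_1+\dots+c_i}$ for $0<i<k$. Node $v_1$ broadcasts the splitters $b_i$ to the heavy nodes. - *Round 4.* Each heavy node sends each of its elements $x$ to the node $v_{i+1}$ with $b_i\le x<b_{i+1}$. Finally each node sorts what it has received. **Theorem.** There is a universal constant $C$ such that, for every symmetric tree topology, every choice of the root and of the left-to-right traversal, every set $R$ of $N$ elements and every initial placement with $N\ge4|V_C|^2\ln(|V_C|\cdot N)$: with probability at least $1-\frac1N$, wTS sorts $R$ along the traversal, in 4 rounds, with cost at most $C\cdot C_{LB}$; and if the domain is infinite, then also, with probability at least $1-\frac1N$, wTS sorts $R$ with cost at most $C\cdot\mathrm{OPT}$. -/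

import Mathlib

open MeasureTheory
open scoped ENNReal NNReal

universe u v

namespace TopologySort

/-! ## Distributed algorithms whose messages consist of elements -/

section Algorithms

variable {P : Type u} {α : Type v}

/-- `x` is stored at a compute node whose initial data is `X` and which, in the `i`-th round so far,
received the set `h[i] w` from the compute node `w`. -/
def Held (X : Finset α) (h : List (P → Finset α)) (x : α) : Prop :=
  x ∈ X ∨ ∃ r ∈ h, ∃ w, x ∈ r w

/-- A randomized algorithm with compute nodes `P` for data from the domain `α`.
In round `i` (counted from `0`) node `u` sends to node `v` the set `send ω u X h v`, where `ω` is the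
outcome of the coin tosses, `X` is the initial data of `u`, and `h`, a list of length `i`, records what
`u` has received from every node in each earlier round. After the last round, node `u` returns the list
`output ω u X h`. A node can send or return only elements that it stores. -/
structure Algorithm (P : Type u) (α : Type v) where
  Seed : Type u
  [seedSpace : MeasurableSpace Seed]
  law : Measure Seed
  [law_prob : IsProbabilityMeasure law]
  rounds : ℕ
  send : Seed → P → Finset α → List (P → Finset α) → P → Finset α
  output : Seed → P → Finset α → List (P → Finset α) → List α
  send_held : ∀ ω u X h v, ∀ x ∈ send ω u X h v, Held X h x
  output_held : ∀ ω u X h, ∀ x ∈ output ω u X h, Held X h x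

attribute [instance] Algorithm.seedSpace Algorithm.law_prob

namespace Algorithm

variable (A : Algorithm P α) (ω : A.Seed) (D : P → Finset α)

/-- What each node has received in the first `i` rounds, started from the placement `D`. -/
def history : ℕ → P → List (P → Finset α)
  | 0, _ => []
  | i + 1, u => history i u ++ [fun w => A.send ω w (D w) (history i w) u]

/-- The set of elements that `u` sends to `w` in round `i`. -/
def message (i : ℕ) (u w : P) : Finset α :=
  A.send ω u (D u) (A.history ω D i u) w

/-- The list that node `u` returns at the end. -/
def result (u : P) : List α :=
  A.output ω u (D u) (A.history ω D A.rounds u)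

end Algorithm

/-- `D` distributes the elements of `R` over the nodes, without duplication, with `n w` of them on
node `w`. -/
structure IsPlacement (R : Finset α) (n : P → ℕ) (D : P → Finset α) : Prop where
  disjoint : Pairwise fun a b => Disjoint (D a) (D b)
  union : ∀ x, x ∈ R ↔ ∃ w, x ∈ D w
  card : ∀ w, (D w).card = n w

/-- The lists `Z w`, concatenated along the ordering `order` of the nodes, list the elements initially
placed by `D`, each once, in increasing order. -/
def IsSorted [LinearOrder α] (order : List P) (D : P → Finset α) (Z : P → List α) : Prop :=
  (order.flatMap Z).Pairwise (· < ·) ∧ ∀ x, x ∈ order.flatMap Z ↔ ∃ w, x ∈ D w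

end Algorithms

/-! ## Symmetric tree topologies -/

/-- A symmetric tree topology: each edge of the tree stands for two directed links, one in each
direction, of the same bandwidth. -/
structure TreeNetwork (V : Type u) where
  graph : SimpleGraph V
  isTree : graph.IsTree
  compute : Finset V
  bandwidth : V → V → ℝ≥0∞
  bandwidth_symm : ∀ a b, graph.Adj a b → bandwidth a b = bandwidth b a

namespace TreeNetwork

variable {V : Type u} (net : TreeNetwork V)

/-- The compute nodes. -/
abbrev Node : Type u := {x : V // x ∈ net.compute}

/-- The path from `a` to `b` in the tree passes through the vertex `x`. -/
def OnPath (a b x : V) : Prop :=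
  ∃ q : net.graph.Walk a b, q.IsPath ∧ x ∈ q.support

/-- The path from `s` to `t` in the tree uses the directed link from `a` to `b`. -/
def UsesLink (s t a b : V) : Prop :=
  ∃ q : net.graph.Walk s t, q.IsPath ∧ ∃ d ∈ q.darts, d.fst = a ∧ d.snd = b

open Classical in
/-- `order` lists the compute nodes in the order of a left-to-right traversal of the tree rooted at
`root`: the compute nodes in the subtree below any vertex `x` are consecutive. -/
def IsTraversal (root : V) (order : List net.Node) : Prop :=
  order.Nodup ∧ (∀ w, w ∈ order) ∧
    ∀ x : V, (order.filter fun w => net.OnPath root w x) <:+: order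

section Cost

variable {α : Type v} [LinearOrder α]

open Classical in
/-- The set of elements that are routed through the directed link from `a` to `b` in round `i`. -/
noncomputable def linkData (A : Algorithm net.Node α) (ω : A.Seed) (D : net.Node → Finset α)
    (i : ℕ) (a b : V) : Finset α :=
  (Finset.univ.filter fun st : net.Node × net.Node => net.UsesLink st.1 st.2 a b).biUnion
    fun st => A.message ω D i st.1 st.2

/-- The (tuple) cost of round `i`. -/
noncomputable def roundCost (A : Algorithm net.Node α) (ω : A.Seed) (D : net.Node → Finset α)
    (i : ℕ) : ℝ≥0∞ :=
  ⨆ (a : V) (b : V) (_ : net.graph.Adj a b),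
    ((net.linkData A ω D i a b).card : ℝ≥0∞) / net.bandwidth a b

/-- The (tuple) cost of a run of `A`. -/
noncomputable def cost (A : Algorithm net.Node α) (ω : A.Seed) (D : net.Node → Finset α) : ℝ≥0∞ :=
  ∑ i ∈ Finset.range A.rounds, net.roundCost A ω D i

/-- With probability at least `p`, the algorithm `A`, started from the placement `D`, sorts the data
along `order` with cost at most `K`. -/
def SortsWithCost (A : Algorithm net.Node α) (order : List net.Node) (D : net.Node → Finset α)
    (K p : ℝ≥0∞) : Prop :=
  ∃ E : Set A.Seed, MeasurableSet E ∧ p ≤ A.law E ∧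
    ∀ ω ∈ E, IsSorted order D (A.result ω D) ∧ net.cost A ω D ≤ K

end Cost

/-- The optimal cost of sorting `N = ∑ w, n w` elements of `α`, when node `w` initially holds `n w` of
them: the infimum of all `K` such that some algorithm (which may depend on the network and on `n`)
sorts every such input, along a traversal of its choice, with cost at most `K` and with probability at
least `1 - 1 / N`. -/
noncomputable def optimalCost (α : Type v) [LinearOrder α] (n : net.Node → ℕ) : ℝ≥0∞ :=
  sInf {K | ∃ (A : Algorithm net.Node α) (root : V) (order : List net.Node),
    net.IsTraversal root order ∧
    ∀ (R : Finset α) (D : net.Node → Finset α), IsPlacement R n D →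
      net.SortsWithCost A order D K (1 - 1 / ((∑ w, n w : ℕ) : ℝ≥0∞))}

open Classical in
/-- The compute nodes on the side of `a` when the edge between `a` and `b` is removed. -/
noncomputable def side (a b : V) : Finset net.Node :=
  Finset.univ.filter fun w => (net.graph.deleteEdges {s(a, b)}).Reachable a w

/-- The maximum over all links of `min (∑_{w ∈ V⁻} n w) (∑_{w ∈ V⁺} n w)` divided by the bandwidth,
where `V⁻` and `V⁺` are the sets of compute nodes on the two sides of the link. -/
noncomputable def lowerBound (n : net.Node → ℕ) : ℝ≥0∞ :=
  ⨆ (a : V) (b : V) (_ : net.graph.Adj a b),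
    ((min (∑ w ∈ net.side a b, n w) (∑ w ∈ net.side b a, n w) : ℕ) : ℝ≥0∞) / net.bandwidth a b

end TreeNetwork

/-! ## The weighted TeraSort algorithm -/

/-- How many of `m` elements go to each of several receivers of weights `as`, the total weight being
`H`: each share is the proportional one, rounded up or down according to the current excess `Δ`. -/
def proportional (H m : ℕ) : ℚ → List ℕ → List ℕ
  | _, [] => []
  | Δ, a :: as =>
    let x : ℚ := (a : ℚ) / H * m
    if x - ⌊x⌋ ≤ Δ then
      ⌊x⌋.toNat :: proportional H m (Δ - (x - ⌊x⌋)) as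
    else
      (⌊x⌋.toNat + 1) :: proportional H m (Δ + 1 - (x - ⌊x⌋)) as

namespace WTS

variable {P : Type u} [Fintype P] (n : P → ℕ) (order : List P)

/-- The total number `N` of elements. -/
def total : ℕ := ∑ w, n w

/-- A compute node is heavy if it holds at least `N / (2 |V_C|)` elements, otherwise light. -/
def IsHeavy (w : P) : Prop :=
  (total n : ℚ) / (2 * Fintype.card P) ≤ n w

instance : DecidablePred (IsHeavy n) := fun w =>
  inferInstanceAs (Decidable ((total n : ℚ) / (2 * Fintype.card P) ≤ n w))

/-- The heavy nodes `v_1, …, v_k` from left to right. -/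
def heavyList : List P := order.filter fun w => IsHeavy n w

/-- The numbers of elements that a light node `w` sends to `v_1, …, v_k`. -/
def shares (w : P) : List ℕ :=
  proportional ((heavyList n order).map n).sum (n w) 0 ((heavyList n order).map n)

/-- The number `M_{j+1}` of elements on `v_{j+1}` after the first round. -/
def load (j : ℕ) : ℕ :=
  ((heavyList n order).map n).getD j 0 +
    ∑ w ∈ Finset.univ.filter (fun w => ¬ IsHeavy n w), (shares n order w).getD j 0

/-- The number `c_{j+1} = ⌈|V_C| * M_{j+1} / N⌉`. -/
def quota (j : ℕ) : ℕ := ⌈(Fintype.card P : ℚ) / total n * load n order j⌉₊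

/-- The sampling probability `4 |V_C| / N * ln (|V_C| * N)`. -/
noncomputable def rho : ℝ :=
  4 * ((Fintype.card P : ℝ) / total n) * Real.log (Fintype.card P * total n)

variable {α : Type v} [LinearOrder α]

/-- The number of elements of `X` that are smaller than `x`. -/
def rank (X : Finset α) (x : α) : ℕ := (X.filter (· < x)).card

/-- All the elements received in a round. -/
def received (r : P → Finset α) : Finset α := Finset.univ.biUnion r

open Classical in
/-- Round 1: each light node deals out its elements to the heavy nodes according to its shares. -/
noncomputable def send₁ (w : P) (X : Finset α) (t : P) : Finset α :=
  if IsHeavy n w then ∅ else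
    X.filter fun x => ∃ i, (heavyList n order)[i]? = some t ∧
      ((shares n order w).take i).sum ≤ rank X x ∧
      rank X x < ((shares n order w).take (i + 1)).sum

open Classical in
/-- Round 2: each heavy node sends to `v_1` those elements of its storage `Y` whose coins show
`true`; the coins of a node are indexed by the positions in its storage. -/
noncomputable def send₂ (ω : P × Fin (total n) → Bool) (w : P) (Y : Finset α) (t : P) : Finset α :=
  if IsHeavy n w ∧ (heavyList n order).head? = some t then
    Y.filter fun x => ∃ i : Fin (total n), (i : ℕ) = rank Y x ∧ ω (w, i) = true
  else ∅

open Classical in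
/-- The finite splitters among `b_1, …, b_{k-1}`, computed from the set `S` of samples:
`b_i = t_j` with `j = c_1 + ⋯ + c_i`, where `t_j` is the `j * ⌈s / |V_C|⌉`-th smallest sample if
`j < |V_C|` and there are that many samples, and `t_j = +∞` otherwise. -/
noncomputable def splitters (S : Finset α) : Finset α :=
  S.filter fun x => ∃ i, 1 ≤ i ∧ i < (heavyList n order).length ∧
    ∑ j ∈ Finset.range i, quota n order j < Fintype.card P ∧
    rank S x + 1 =
      (∑ j ∈ Finset.range i, quota n order j) * ⌈(S.card : ℚ) / Fintype.card P⌉₊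

open Classical in
/-- Round 3: `v_1` broadcasts the splitters to the heavy nodes. -/
noncomputable def send₃ (w : P) (S : Finset α) (t : P) : Finset α :=
  if (heavyList n order).head? = some w ∧ IsHeavy n t then splitters n order S else ∅

open Classical in
/-- Round 4: each heavy node sends every element `x` of its storage `Y` to `v_{i+1}`, where
`b_i ≤ x < b_{i+1}`, that is, where `i` is the number of splitters in `B` that are at most `x`. -/
noncomputable def send₄ (w : P) (Y B : Finset α) (t : P) : Finset α :=
  if IsHeavy n w then
    Y.filter fun x => (heavyList n order)[(B.filter (· ≤ x)).card]? = some t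
  else ∅

/-- What node `w` with initial data `X` sends to node `t`; the last argument `h` records what `w`
received in the earlier rounds, so that its length tells the round. -/
noncomputable def send (ω : P × Fin (total n) → Bool) (w : P) (X : Finset α)
    (h : List (P → Finset α)) (t : P) : Finset α :=
  match h with
  | [] => send₁ n order w X t
  | [r₁] => send₂ n order ω w (X ∪ received r₁) t
  | [_, r₂] => send₃ n order w (received r₂) t
  | [r₁, _, r₃] => send₄ n order w (X ∪ received r₁) (received r₃) t
  | _ => ∅

/-- At the end each node sorts what it received in round 4. -/
def output (h : List (P → Finset α)) : List α :=
  match h with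
  | [_, _, _, r₄] => (received r₄).sort (· ≤ ·)
  | _ => []

theorem send_held (ω : P × Fin (total n) → Bool) (w : P) (X : Finset α)
    (h : List (P → Finset α)) (t : P) : ∀ x ∈ send n order ω w X h t, Held X h x := by
  classical
  intro x hx
  unfold send at hx
  split at hx
  · unfold send₁ at hx
    split at hx
    · simp at hx
    · exact Or.inl (Finset.mem_filter.1 hx).1
  · unfold send₂ at hx
    split at hx
    · simpa [Held, received] using (Finset.mem_filter.1 hx).1
    · simp at hx
  · unfold send₃ at hx
    split at hx
    · have h1 := (Finset.mem_filter.1 hx).1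
      simp only [received, Finset.mem_biUnion, Finset.mem_univ, true_and] at h1
      exact Or.inr ⟨_, by simp, h1⟩
    · simp at hx
  · unfold send₄ at hx
    split at hx
    · have h1 := (Finset.mem_filter.1 hx).1
      simp only [received, Finset.mem_union, Finset.mem_biUnion, Finset.mem_univ, true_and] at h1
      exact h1.imp id fun h1 => ⟨_, by simp, h1⟩
    · simp at hx
  · simp at hx

theorem output_held (X : Finset α) (h : List (P → Finset α)) :
    ∀ x ∈ output h, Held X h x := by
  intro x hx
  unfold output at hx
  split at hx
  · simp only [received, Finset.mem_sort, Finset.mem_biUnion, Finset.mem_univ, true_and] at hx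
    exact Or.inr ⟨_, by simp, hx⟩
  · simp at hx

end WTS

/-- The weighted TeraSort algorithm for initial data sizes `n` and the ordering `order` of the compute
nodes. All its coins are independent and show `true` with probability `WTS.rho n` (cut off to the
interval from `0` to `1`). -/
noncomputable def weightedTeraSort {P : Type u} [Fintype P] (n : P → ℕ) (order : List P)
    (α : Type v) [LinearOrder α] : Algorithm P α where
  Seed := P × Fin (WTS.total n) → Bool
  law := Measure.pi fun _ =>
    ProbabilityTheory.bernoulliMeasure true false (Set.projIcc 0 1 zero_le_one (WTS.rho n))
  rounds := 4
  send := WTS.send n order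
  output := fun _ _ _ h => WTS.output h
  send_held := WTS.send_held n order
  output_held := fun _ _ => WTS.output_held

end TopologySort

/-! Write p for the number of compute nodes, N for the total amount of data, n_v for the initial
amount on v.

Upper bound. A path uses the link from a to b exactly when it starts on the side of a and ends on
the side of b. So if in some round every node v sends and receives at most c·n_v elements, each link
carries at most c times the smaller side total, and the round costs at most c·C_LB (`roundCost_le`).
Four rounds with c = 135 give 540·C_LB. Heavy nodes hold at least half of the data, so proportional
dealing leaves at most 3·n_v elements on a heavy v (`load_le`), while the p-sized rounding errors
and splitter sets are absorbed because heavy nodes hold at least p elements. The delicate quantity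
is the amount received in round 4. A bucket with quota c_j contains at most c_j⌈s/p⌉ + 1 samples
(`card_samples_le`). Chernoff bounds and a union bound over the N² intervals with end points in R
show that, with probability at least 1 - 1/N, s is O(p ln(pN)) and every interval of at least 4N/p
elements contains at least a quarter of its expected number of samples (`le_law_goodSample`). Hence
a bucket has O(c_j N/p) = O(n_v) elements (`card_bucket_le`). Correctness does not depend on the
coins, since the number of splitters below an element is monotone (`isSorted`).

Lower bound. Let m be the smaller side total of an edge. Along a traversal the nodes on the side
away from the root are consecutive. If the data of the two sides alternate in the order of the
domain, then the pairs of neighbours, with at most one exception, lose an element across the edge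
(`le_card_crossing_add_one`), so (m - 1)/w ≤ 2·OPT; the 2 stands for the two directions. The missing
unit comes from an indistinguishability argument: without communication one side cannot tell whether
the other side's data are all smaller or all larger than its own (`one_div_bandwidth_le`). Together
C_LB ≤ 4·OPT. -/

namespace TopologySort

/-! ## Links of a tree -/

section Tree

variable {V : Type u} {G : SimpleGraph V}

theorem reachable_deleteEdges_of_not_mem_edges {s t a b : V} (q : G.Walk s t)
    (h : s(a, b) ∉ q.edges) : (G.deleteEdges {s(a, b)}).Reachable s t :=
  ⟨q.toDeleteEdges {s(a, b)} fun e he hm => h (by rwa [Set.mem_singleton_iff.1 hm] at he)⟩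

/-- A trail uses an edge at most once, so the parts before and after that use survive the deletion
of the edge. -/
theorem reachable_deleteEdges_of_mem_darts {a b : V} :
    ∀ {s t : V} (q : G.Walk s t), q.IsTrail → ∀ d ∈ q.darts, d.fst = a → d.snd = b →
      (G.deleteEdges {s(a, b)}).Reachable a s ∧ (G.deleteEdges {s(a, b)}).Reachable b t := by
  intro s t q
  induction q with
  | nil => simp
  | @cons x y z hxy q ih =>
    intro hq d hd ha hb
    rw [SimpleGraph.Walk.isTrail_cons] at hq
    rw [SimpleGraph.Walk.darts_cons, List.mem_cons] at hd
    rcases hd with rfl | hd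
    · dsimp only at ha hb
      subst ha hb
      exact ⟨SimpleGraph.Reachable.refl _, reachable_deleteEdges_of_not_mem_edges q hq.2⟩
    · obtain ⟨h1, h2⟩ := ih hq.1 d hd ha hb
      refine ⟨h1.trans (SimpleGraph.Adj.reachable ?_), h2⟩
      rw [SimpleGraph.deleteEdges_adj]
      refine ⟨hxy.symm, fun hm => hq.2 ?_⟩
      have : d.edge ∈ q.edges := by
        rw [SimpleGraph.Walk.edges_eq_map_darts]; exact List.mem_map_of_mem hd
      have hde : d.edge = s(a, b) := by
        rw [← ha, ← hb]; rfl
      rw [Set.mem_singleton_iff] at hm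
      rwa [Sym2.eq_swap, hm, ← hde]

theorem exists_dart_of_mem_edges {s t a b : V} (q : G.Walk s t) (h : s(a, b) ∈ q.edges) :
    ∃ d ∈ q.darts, (d.fst = a ∧ d.snd = b) ∨ (d.fst = b ∧ d.snd = a) := by
  rw [SimpleGraph.Walk.edges_eq_map_darts, List.mem_map] at h
  obtain ⟨d, hd, he⟩ := h
  refine ⟨d, hd, ?_⟩
  obtain ⟨⟨x, y⟩, hxy⟩ := d
  simpa [SimpleGraph.Dart.edge] using he

variable (hG : G.IsTree) {a b : V} (hab : G.Adj a b)
include hG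

theorem reachable_or_reachable (w : V) :
    (G.deleteEdges {s(a, b)}).Reachable a w ∨ (G.deleteEdges {s(a, b)}).Reachable b w := by
  obtain ⟨q, hq, -⟩ := hG.existsUnique_path w a
  by_cases h : s(a, b) ∈ q.edges
  · obtain ⟨d, hd, ⟨h1, h2⟩ | ⟨h1, h2⟩⟩ := exists_dart_of_mem_edges q h
    · exact Or.inl (reachable_deleteEdges_of_mem_darts q hq.isTrail d hd h1 h2).1
    · right
      have := (reachable_deleteEdges_of_mem_darts q hq.isTrail d hd h1 h2).1
      rwa [Sym2.eq_swap]
  · exact Or.inl (reachable_deleteEdges_of_not_mem_edges q h).symm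

include hab

theorem not_reachable_both (w : V) :
    ¬ ((G.deleteEdges {s(a, b)}).Reachable a w ∧ (G.deleteEdges {s(a, b)}).Reachable b w) :=
  fun h => SimpleGraph.isAcyclic_iff_forall_adj_isBridge.1 hG.isAcyclic hab
    (h.1.trans h.2.symm)

/-- A path avoiding the edge would join the two sides after its deletion, and a path using it
backwards would put `s` on the side of `b`; both contradict that edges of a tree are bridges. -/
theorem exists_dart_of_reachable {s t : V} (hs : (G.deleteEdges {s(a, b)}).Reachable a s)
    (ht : (G.deleteEdges {s(a, b)}).Reachable b t) :
    ∃ q : G.Walk s t, q.IsPath ∧ ∃ d ∈ q.darts, d.fst = a ∧ d.snd = b := by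
  obtain ⟨q, hq, -⟩ := hG.existsUnique_path s t
  refine ⟨q, hq, ?_⟩
  by_cases h : s(a, b) ∈ q.edges
  · obtain ⟨d, hd, h' | ⟨h1, h2⟩⟩ := exists_dart_of_mem_edges q h
    · exact ⟨d, hd, h'⟩
    · have := (reachable_deleteEdges_of_mem_darts q hq.isTrail d hd h1 h2).1
      rw [Sym2.eq_swap] at this
      exact absurd ⟨hs, this⟩ (not_reachable_both hG hab s)
  · exact absurd ⟨hs.trans (reachable_deleteEdges_of_not_mem_edges q h), ht⟩
      (not_reachable_both hG hab t)

/-- A path from the side of `a` can reach `b` only over the edge. Thus the subtree below `b` in the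
tree rooted at `r` is the whole side of `b`, which links traversals to sides. -/
theorem exists_isPath_through_iff {r w : V} (hr : (G.deleteEdges {s(a, b)}).Reachable a r) :
    (∃ q : G.Walk r w, q.IsPath ∧ b ∈ q.support) ↔
      (G.deleteEdges {s(a, b)}).Reachable b w := by
  classical
  constructor
  · rintro ⟨q, hq, hb⟩
    by_cases h : s(a, b) ∈ q.edges
    · obtain ⟨d, hd, ⟨h1, h2⟩ | ⟨h1, h2⟩⟩ := exists_dart_of_mem_edges q h
      · exact (reachable_deleteEdges_of_mem_darts q hq.isTrail d hd h1 h2).2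
      · have := (reachable_deleteEdges_of_mem_darts q hq.isTrail d hd h1 h2).1
        rw [Sym2.eq_swap] at this
        exact absurd ⟨hr, this⟩ (not_reachable_both hG hab r)
    · have : (G.deleteEdges {s(a, b)}).Reachable r b :=
        reachable_deleteEdges_of_not_mem_edges (q.takeUntil b hb)
          fun hm => h (q.edges_takeUntil_subset_edges hb hm)
      exact absurd ⟨hr.trans this, SimpleGraph.Reachable.refl _⟩ (not_reachable_both hG hab b)
  · intro hw
    obtain ⟨q, hq, d, hd, -, hd2⟩ := exists_dart_of_reachable hG hab hr hw
    exact ⟨q, hq, hd2 ▸ q.dart_snd_mem_support_of_mem_darts hd⟩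

end Tree

/-! ### Sides of an edge, traversals and the cost of a round -/

namespace TreeNetwork

variable {V : Type u} (net : TreeNetwork V) {a b : V}

theorem mem_side {w : net.Node} :
    w ∈ net.side a b ↔ (net.graph.deleteEdges {s(a, b)}).Reachable a w := by
  simp [side]

theorem mem_side_swap {w : net.Node} :
    w ∈ net.side b a ↔ (net.graph.deleteEdges {s(a, b)}).Reachable b w := by
  rw [mem_side, Sym2.eq_swap]

theorem mem_side_swap_iff (hab : net.graph.Adj a b) (w : net.Node) :
    w ∈ net.side b a ↔ w ∉ net.side a b := by
  rw [mem_side_swap, mem_side]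
  have h1 := reachable_or_reachable (a := a) (b := b) net.isTree w
  have h2 := not_reachable_both net.isTree hab w
  tauto

theorem usesLink_iff (hab : net.graph.Adj a b) (s t : net.Node) :
    net.UsesLink s t a b ↔ s ∈ net.side a b ∧ t ∈ net.side b a := by
  rw [mem_side, mem_side_swap]
  constructor
  · rintro ⟨q, hq, d, hd, h1, h2⟩
    exact reachable_deleteEdges_of_mem_darts q hq.isTrail d hd h1 h2
  · rintro ⟨hs, ht⟩
    exact exists_dart_of_reachable net.isTree hab hs ht

/-- On a traversal, the compute nodes on the side of an edge that does not contain the root are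
consecutive. -/
theorem IsTraversal.exists_split {root : V} {order : List net.Node}
    (h : net.IsTraversal root order) (hab : net.graph.Adj a b)
    (hr : (net.graph.deleteEdges {s(a, b)}).Reachable a root) :
    ∃ l₁ l₂ l₃ : List net.Node, order = l₁ ++ l₂ ++ l₃ ∧ (∀ w ∈ l₁, w ∈ net.side a b) ∧
      (∀ w ∈ l₂, w ∈ net.side b a) ∧ ∀ w ∈ l₃, w ∈ net.side a b := by
  classical
  -- The infix condition of `IsTraversal` concerns lists over `V`, into which `order` is coerced
  -- monadically. It is rewritten with `List.map`, and the decomposition is pulled back along the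
  -- injective `Subtype.val`.
  have hmap : (order >>= fun w => pure (w : V)) = order.map Subtype.val := by
    simp
  have hinf := h.2.2 b
  rw [hmap, List.filter_map] at hinf
  obtain ⟨k₁, k₃, hk⟩ := hinf
  obtain ⟨l, l₃, hl, hl', rfl⟩ := List.map_eq_append_iff.1 hk.symm
  obtain ⟨l₁, l₂, rfl, rfl, h₂⟩ := List.map_eq_append_iff.1 hl'
  have hl₂ := List.map_injective_iff.2 Subtype.val_injective h₂
  have hon : ∀ w : net.Node, net.OnPath root w b ↔ w ∈ net.side b a := fun w => by
    rw [mem_side_swap]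
    exact exists_isPath_through_iff net.isTree hab hr
  have hnd := h.1
  have key : ∀ w : net.Node, w ∉ net.side a b → w ∈ l₂ := fun w h2 => by
    rw [hl₂]
    refine List.mem_filter.2 ⟨h.2.1 w, ?_⟩
    simpa [hon, net.mem_side_swap_iff hab] using h2
  rw [hl, List.nodup_append, List.nodup_append] at hnd
  refine ⟨l₁, l₂, l₃, hl, fun w hw => ?_, fun w hw => ?_, fun w hw => ?_⟩
  · by_contra hc
    exact hnd.1.2.2 w hw w (key w hc) rfl
  · rw [hl₂] at hw
    simpa [hon] using (List.mem_filter.1 hw).2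
  · by_contra hc
    exact hnd.2.2 w (List.mem_append_right _ (key w hc)) w hw rfl

section Cost

variable {α : Type v} [LinearOrder α] (A : Algorithm net.Node α) (ω : A.Seed)
  (D : net.Node → Finset α) (i : ℕ)

open Classical in
theorem linkData_eq (hab : net.graph.Adj a b) :
    net.linkData A ω D i a b =
      (net.side a b).biUnion fun s => (net.side b a).biUnion fun t => A.message ω D i s t := by
  ext x
  simp only [linkData, Finset.mem_biUnion, Finset.mem_filter, Finset.mem_univ, true_and,
    net.usesLink_iff hab]
  constructor
  · rintro ⟨st, ⟨h1, h2⟩, hx⟩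
    exact ⟨st.1, h1, st.2, h2, hx⟩
  · rintro ⟨s, h1, t, h2, hx⟩
    exact ⟨(s, t), ⟨h1, h2⟩, hx⟩

/-- If every node sends and receives in round `i` at most `c` times as much data as it holds
initially, then the cost of the round is at most `c` times the lower bound. -/
theorem roundCost_le (n : net.Node → ℕ) (c : ℕ)
    (hs : ∀ s, (Finset.univ.biUnion fun t => A.message ω D i s t).card ≤ c * n s)
    (ht : ∀ t, (Finset.univ.biUnion fun s => A.message ω D i s t).card ≤ c * n t) :
    net.roundCost A ω D i ≤ c * net.lowerBound n := by
  classical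
  refine iSup_le fun a => iSup_le fun b => iSup_le fun hab => ?_
  -- The data on the link are counted once by their senders and once by their receivers; the two
  -- counts give the two arguments of the minimum.
  have h1 : (net.linkData A ω D i a b).card ≤ c * ∑ w ∈ net.side a b, n w := by
    rw [linkData_eq net A ω D i hab, Finset.mul_sum]
    refine Finset.card_biUnion_le.trans (Finset.sum_le_sum fun s _ => (hs s).trans' ?_)
    exact Finset.card_le_card (Finset.biUnion_subset_biUnion_of_subset_left _
      (Finset.subset_univ _))
  have h2 : (net.linkData A ω D i a b).card ≤ c * ∑ w ∈ net.side b a, n w := by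
    have hcomm : net.linkData A ω D i a b = (net.side b a).biUnion fun t =>
        (net.side a b).biUnion fun s => A.message ω D i s t := by
      rw [linkData_eq net A ω D i hab]
      ext x
      simp only [Finset.mem_biUnion]
      tauto
    rw [hcomm, Finset.mul_sum]
    refine Finset.card_biUnion_le.trans (Finset.sum_le_sum fun s _ => (ht s).trans' ?_)
    exact Finset.card_le_card (Finset.biUnion_subset_biUnion_of_subset_left _
      (Finset.subset_univ _))
  have h3 : (net.linkData A ω D i a b).card ≤
      c * min (∑ w ∈ net.side a b, n w) (∑ w ∈ net.side b a, n w) := by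
    rcases min_choice (∑ w ∈ net.side a b, n w) (∑ w ∈ net.side b a, n w) with h | h <;>
      rw [h] <;> assumption
  calc ((net.linkData A ω D i a b).card : ℝ≥0∞) / net.bandwidth a b
      ≤ ((c * min (∑ w ∈ net.side a b, n w) (∑ w ∈ net.side b a, n w) : ℕ) : ℝ≥0∞) /
          net.bandwidth a b := ENNReal.div_le_div_right (by exact_mod_cast h3) _
    _ = c * (((min (∑ w ∈ net.side a b, n w) (∑ w ∈ net.side b a, n w) : ℕ) : ℝ≥0∞) /
          net.bandwidth a b) := by rw [Nat.cast_mul, mul_div_assoc]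
    _ ≤ c * net.lowerBound n := by
        refine mul_le_mul_right ?_ _
        exact le_iSup_of_le a (le_iSup_of_le b (le_iSup_of_le hab le_rfl))

end Cost

end TreeNetwork

/-! ## Concentration of independent coins -/

section Coins

variable {ι : Type*} [Fintype ι] (p : unitInterval)

/-- Independent coins that show `true` with probability `p`. -/
noncomputable def coins (ι : Type*) [Fintype ι] (p : unitInterval) : Measure (ι → Bool) :=
  Measure.pi fun _ => ProbabilityTheory.bernoulliMeasure true false p

instance : IsProbabilityMeasure (coins ι p) := by unfold coins; infer_instance

/-- The number of coins in `T` that show `true`. -/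
def heads (T : Finset ι) (ω : ι → Bool) : ℕ := (T.filter fun i => ω i = true).card

/-- The exponential of a count is a product over the coins, so by independence the integral factors
into single-coin moment generating functions. -/
theorem integral_exp_mul_heads (T : Finset ι) (θ : ℝ) :
    ∫ ω, Real.exp (θ * heads T ω) ∂(coins ι p) = (1 + (Real.exp θ - 1) * p) ^ T.card := by
  classical
  have h : ∀ ω : ι → Bool, Real.exp (θ * heads T ω) =
      ∏ i, (if i ∈ T then (if ω i = true then Real.exp θ else 1) else 1) := by
    intro ω
    rw [Finset.prod_ite_mem, Finset.univ_inter, Finset.prod_ite, Finset.prod_const,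
      Finset.prod_const_one, mul_one, ← Real.exp_nat_mul, mul_comm]
    rfl
  simp_rw [h]
  rw [coins, integral_fintype_prod_eq_prod
    (f := fun i (x : Bool) => if i ∈ T then (if x = true then Real.exp θ else 1) else 1)]
  have h2 : ∀ i, ∫ x, (if i ∈ T then (if x = true then Real.exp θ else 1) else 1)
      ∂(ProbabilityTheory.bernoulliMeasure true false p) =
      if i ∈ T then 1 + (Real.exp θ - 1) * p else 1 := by
    intro i
    rw [ProbabilityTheory.integral_bernoulliMeasure]
    split_ifs <;> simp_all
    ring
  simp_rw [h2]
  rw [Finset.prod_ite_mem, Finset.univ_inter, Finset.prod_const]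

/-- Chernoff's bound: Markov's inequality for the exponential, then 1 + x ≤ exp x. The sign of `θ`
is free, so that `θ = 1` serves the upper tail and `θ = -1` the lower one. -/
theorem measure_le_exp_mul_heads (T : Finset ι) (θ c : ℝ) :
    coins ι p {ω | c ≤ θ * heads T ω} ≤
      ENNReal.ofReal (Real.exp ((Real.exp θ - 1) * p * T.card - c)) := by
  have h1 := mul_meas_ge_le_integral_of_nonneg (μ := coins ι p)
    (f := fun ω => Real.exp (θ * heads T ω)) (ae_of_all _ fun ω => (Real.exp_pos _).le)
    Integrable.of_finite (Real.exp c)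
  rw [integral_exp_mul_heads] at h1
  have h2 : (1 + (Real.exp θ - 1) * p) ^ T.card ≤ Real.exp ((Real.exp θ - 1) * p * T.card) := by
    rw [mul_comm _ (T.card : ℝ), Real.exp_nat_mul]
    refine pow_le_pow_left₀ ?_ (by rw [add_comm]; exact Real.add_one_le_exp _) _
    have := p.2.1
    have := p.2.2
    nlinarith [Real.exp_pos θ]
  have h3 : {ω : ι → Bool | Real.exp c ≤ Real.exp (θ * heads T ω)} =
      {ω | c ≤ θ * heads T ω} := by simp
  rw [h3] at h1
  rw [ENNReal.le_ofReal_iff_toReal_le (measure_ne_top _ _) (Real.exp_pos _).le, Real.exp_sub,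
    le_div_iff₀ (Real.exp_pos _), mul_comm]
  exact h1.trans h2

end Coins

/-! ## Proportional shares -/

section Shares

/-- `Δ` is the exact excess of what has been dealt out over the ideal amount, and the rounding rule
keeps it in [0, 1). The starting value is general for the sake of the induction. -/
theorem proportional_bounds (H m : ℕ) (as : List ℕ) :
    ∀ Δ : ℚ, 0 ≤ Δ → Δ < 1 → ∀ i,
      (((as.take i).sum : ℕ) : ℚ) / H * m ≤ ((proportional H m Δ as).take i).sum + Δ ∧
      ((((proportional H m Δ as).take i).sum : ℕ) : ℚ) + Δ <
        (((as.take i).sum : ℕ) : ℚ) / H * m + 1 := by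
  induction as with
  | nil => intro Δ h0 h1 i; simp [proportional, h0, h1]
  | cons a as ih =>
    intro Δ h0 h1 i
    rcases i with _ | i
    · simp [h0, h1]
    have hx : (0 : ℚ) ≤ (a : ℚ) / H * m := by positivity
    have hfl : ((⌊(a : ℚ) / H * m⌋.toNat : ℕ) : ℚ) = ⌊(a : ℚ) / H * m⌋ := by
      have h := Int.toNat_of_nonneg (Int.floor_nonneg.2 hx)
      exact_mod_cast congrArg (Int.cast (R := ℚ)) h
    have hf1 := Int.floor_le ((a : ℚ) / H * m)
    have hf2 := Int.lt_floor_add_one ((a : ℚ) / H * m)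
    simp only [proportional]
    split_ifs with hc
    · obtain ⟨h2, h3⟩ := ih (Δ - ((a : ℚ) / H * m - ⌊(a : ℚ) / H * m⌋)) (by linarith)
        (by linarith) i
      simp only [List.take_succ_cons, List.sum_cons, Nat.cast_add, hfl, add_div, add_mul]
      constructor <;> linarith
    · obtain ⟨h2, h3⟩ := ih (Δ + 1 - ((a : ℚ) / H * m - ⌊(a : ℚ) / H * m⌋)) (by linarith)
        (by linarith) i
      simp only [List.take_succ_cons, List.sum_cons, Nat.cast_add, hfl, add_div, add_mul,
        Nat.cast_one]
      constructor <;> linarith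

theorem length_proportional (H m : ℕ) (as : List ℕ) (Δ : ℚ) :
    (proportional H m Δ as).length = as.length := by
  induction as generalizing Δ with
  | nil => rfl
  | cons a as ih => simp only [proportional]; split_ifs <;> simp [ih]

/-- Whatever `Δ` is, a share is at most ⌊x⌋ + 1. -/
theorem proportional_getD_le (H m : ℕ) (as : List ℕ) (Δ : ℚ) (i : ℕ) :
    (((proportional H m Δ as).getD i 0 : ℕ) : ℚ) ≤ ((as.getD i 0 : ℕ) : ℚ) / H * m + 1 := by
  induction as generalizing Δ i with
  | nil => simp [proportional]
  | cons a as ih =>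
    have hx : (0 : ℚ) ≤ (a : ℚ) / H * m := by positivity
    have hfl : ((⌊(a : ℚ) / H * m⌋.toNat : ℕ) : ℚ) = ⌊(a : ℚ) / H * m⌋ := by
      have h := Int.toNat_of_nonneg (Int.floor_nonneg.2 hx)
      exact_mod_cast congrArg (Int.cast (R := ℚ)) h
    have hf1 := Int.floor_le ((a : ℚ) / H * m)
    simp only [proportional]
    rcases i with _ | i
    · split_ifs <;> simp [hfl] <;> linarith
    · split_ifs <;> simpa using ih _ i

/-- All elements are dealt out. -/
theorem sum_proportional (m : ℕ) (as : List ℕ) (h : as.sum ≠ 0) :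
    (proportional as.sum m 0 as).sum = m := by
  -- For the whole list the ideal amount is `m` itself, so the dealt total is an integer in [m, m +
  -- 1).
  obtain ⟨h1, h2⟩ := proportional_bounds as.sum m as 0 le_rfl one_pos as.length
  rw [List.take_length, ← length_proportional as.sum m as 0, List.take_length, div_self
    (by exact_mod_cast h), one_mul, add_zero] at h1 h2
  have h1' : m ≤ (proportional as.sum m 0 as).sum := by exact_mod_cast h1
  have h2' : (proportional as.sum m 0 as).sum < m + 1 := by exact_mod_cast h2
  omega

/-- A number below the sum of a list lies in one of the intervals between consecutive partial
sums. -/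
theorem exists_take_sum_le_lt (l : List ℕ) (r : ℕ) (h : r < l.sum) :
    ∃ i < l.length, (l.take i).sum ≤ r ∧ r < (l.take (i + 1)).sum := by
  induction l generalizing r with
  | nil => simp at h
  | cons a l ih =>
    by_cases hr : r < a
    · exact ⟨0, by simp, by simp, by simpa using hr⟩
    · obtain ⟨i, hi, h1, h2⟩ := ih (r - a) (by simp at h; omega)
      refine ⟨i + 1, by simpa using hi, ?_, ?_⟩
      · simp; omega
      · rw [List.take_succ_cons, List.sum_cons]; omega

end Shares

namespace WTS

/-! ## Ranks -/

section Rank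

variable {α : Type v} [LinearOrder α] {X : Finset α} {x y : α}

theorem rank_mono (h : x ≤ y) : rank X x ≤ rank X y :=
  Finset.card_le_card fun z hz => by
    rw [Finset.mem_filter] at hz ⊢
    exact ⟨hz.1, hz.2.trans_le h⟩

theorem rank_lt_rank (hx : x ∈ X) (h : x < y) : rank X x < rank X y :=
  Finset.card_lt_card <| (Finset.ssubset_iff_of_subset fun z hz => by
    rw [Finset.mem_filter] at hz ⊢
    exact ⟨hz.1, hz.2.trans h⟩).2 ⟨x, by simp [hx, h], by simp⟩

theorem rank_lt_card (hx : x ∈ X) : rank X x < X.card :=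
  Finset.card_lt_card <| (Finset.ssubset_iff_of_subset (Finset.filter_subset _ _)).2
    ⟨x, hx, by simp⟩

theorem rank_injOn : Set.InjOn (rank X) X := by
  intro x hx y hy h
  rcases lt_trichotomy x y with h' | h' | h'
  · exact absurd h (rank_lt_rank hx h').ne
  · exact h'
  · exact absurd h (rank_lt_rank hy h').ne'

theorem le_of_rank_le (hy : y ∈ X) (h : rank X x ≤ rank X y) : x ≤ y :=
  not_lt.1 fun h' => absurd (rank_lt_rank hy h') h.not_gt

theorem exists_rank_eq {r : ℕ} (h : r < X.card) : ∃ x ∈ X, rank X x = r := by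
  have h1 : X.image (rank X) = Finset.range X.card := by
    refine Finset.eq_of_subset_of_card_le ?_ ?_
    · intro r hr
      obtain ⟨x, hx, rfl⟩ := Finset.mem_image.1 hr
      exact Finset.mem_range.2 (rank_lt_card hx)
    · rw [Finset.card_range, Finset.card_image_of_injOn rank_injOn]
  have h2 : r ∈ X.image (rank X) := by rw [h1]; exact Finset.mem_range.2 h
  exact Finset.mem_image.1 h2

theorem card_filter_rank_le (a b : ℕ) (Y : Finset α) (hY : Y ⊆ X)
    (h : ∀ x ∈ Y, a ≤ rank X x ∧ rank X x < b) : Y.card ≤ b - a := by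
  rw [← Nat.card_Ico]
  refine Finset.card_le_card_of_injOn (rank X) (fun x hx => ?_)
    (rank_injOn.mono (by exact_mod_cast hY))
  simpa using h x hx

end Rank

/-! ## Loads of the heavy nodes -/

section Loads

variable {P : Type u} [Fintype P] {n : P → ℕ} {order : List P}

theorem mem_heavyList (hmem : ∀ w, w ∈ order) {w : P} : w ∈ heavyList n order ↔ IsHeavy n w := by
  simp [heavyList, hmem]

theorem nodup_heavyList (hnd : order.Nodup) : (heavyList n order).Nodup := hnd.filter _

theorem sum_heavyList {M : Type*} [AddCommMonoid M] (hnd : order.Nodup) (hmem : ∀ w, w ∈ order)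
    (f : P → M) :
    ((heavyList n order).map f).sum = ∑ w ∈ Finset.univ.filter (IsHeavy n), f w := by
  classical
  rw [← List.sum_toFinset f (nodup_heavyList hnd)]
  congr 1
  ext w
  simp [mem_heavyList hmem]

theorem sum_light_le [Nonempty P] :
    2 * ∑ w ∈ Finset.univ.filter (fun w => ¬ IsHeavy n w), n w ≤ total n := by
  have hp : (0 : ℚ) < Fintype.card P := by exact_mod_cast Fintype.card_pos
  have h1 : (∑ w ∈ Finset.univ.filter (fun w => ¬ IsHeavy n w), (n w : ℚ)) ≤
      ∑ w ∈ Finset.univ.filter (fun w => ¬ IsHeavy n w),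
        (total n : ℚ) / (2 * Fintype.card P) := by
    refine Finset.sum_le_sum fun w hw => ?_
    have := (Finset.mem_filter.1 hw).2
    rw [IsHeavy, not_le] at this
    exact this.le
  have h2 : (∑ w ∈ Finset.univ.filter (fun w => ¬ IsHeavy n w),
        (total n : ℚ) / (2 * Fintype.card P)) ≤ total n / 2 := by
    rw [Finset.sum_const, nsmul_eq_mul]
    have h3 : ((Finset.univ.filter (fun w => ¬ IsHeavy n w)).card : ℚ) ≤ Fintype.card P := by
      exact_mod_cast Finset.card_le_univ _
    calc _ ≤ (Fintype.card P : ℚ) * ((total n : ℚ) / (2 * Fintype.card P)) := by gcongr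
      _ = _ := by field_simp
  have h4 := h1.trans h2
  have h5 : (2 * ∑ w ∈ Finset.univ.filter (fun w => ¬ IsHeavy n w), (n w : ℚ)) ≤ total n := by
    linarith
  exact_mod_cast h5

theorem total_eq_add (n : P → ℕ) : total n = ∑ w ∈ Finset.univ.filter (IsHeavy n), n w +
    ∑ w ∈ Finset.univ.filter (fun w => ¬ IsHeavy n w), n w :=
  (Finset.sum_filter_add_sum_filter_not _ _ _).symm

theorem sum_light_le_heavyList [Nonempty P] (hnd : order.Nodup) (hmem : ∀ w, w ∈ order) :
    ∑ w ∈ Finset.univ.filter (fun w => ¬ IsHeavy n w), n w ≤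
      ((heavyList n order).map n).sum := by
  rw [sum_heavyList hnd hmem]
  have := sum_light_le (n := n)
  have := total_eq_add n
  omega

theorem sum_heavyList_pos [Nonempty P] (hnd : order.Nodup) (hmem : ∀ w, w ∈ order)
    (hN : 0 < total n) : 0 < ((heavyList n order).map n).sum := by
  rw [sum_heavyList hnd hmem]
  have := sum_light_le (n := n)
  have := total_eq_add n
  omega

theorem heavyList_ne_nil [Nonempty P] (hnd : order.Nodup) (hmem : ∀ w, w ∈ order)
    (hN : 0 < total n) : heavyList n order ≠ [] := by
  intro h
  have := sum_heavyList_pos hnd hmem hN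
  simp [h] at this

theorem length_shares (w : P) :
    (shares n order w).length = (heavyList n order).length := by
  simp [shares, length_proportional]

theorem sum_shares [Nonempty P] (hnd : order.Nodup) (hmem : ∀ w, w ∈ order)
    (hN : 0 < total n) (w : P) : (shares n order w).sum = n w :=
  sum_proportional _ _ (sum_heavyList_pos hnd hmem hN).ne'

/-- Lets a heavy node absorb additive terms of size |V_C|: the roundings of round 1 and the
splitters of round 3. -/
theorem IsHeavy.card_le [Nonempty P] (hN : 2 * Fintype.card P ^ 2 ≤ total n) {w : P}
    (hw : IsHeavy n w) : Fintype.card P ≤ n w := by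
  have hp : (0 : ℚ) < Fintype.card P := by exact_mod_cast Fintype.card_pos
  have h : (2 * Fintype.card P ^ 2 : ℚ) ≤ total n := by exact_mod_cast hN
  have h2 : (Fintype.card P : ℚ) ≤ n w := by
    refine le_trans ?_ hw
    rw [le_div_iff₀ (by positivity)]
    linarith
  exact_mod_cast h2

/-- The first round at most triples the data of a heavy node. -/
theorem load_le [Nonempty P] (hnd : order.Nodup) (hmem : ∀ w, w ∈ order)
    (hN : 2 * Fintype.card P ^ 2 ≤ total n) {j : ℕ} {w : P}
    (hw : (heavyList n order)[j]? = some w) : load n order j ≤ 3 * n w := by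
  have hp : 0 < Fintype.card P := Fintype.card_pos
  have hN0 : 0 < total n := lt_of_lt_of_le (by positivity) hN
  have hj : ((heavyList n order).map n).getD j 0 = n w := by
    simp [List.getD_eq_getElem?_getD, hw]
  have hheavy : IsHeavy n w := (mem_heavyList hmem).1 (List.mem_of_getElem? hw)
  have hH : (0 : ℚ) < (((heavyList n order).map n).sum : ℕ) := by
    exact_mod_cast sum_heavyList_pos hnd hmem hN0
  have h1 : ((∑ u ∈ Finset.univ.filter (fun u => ¬ IsHeavy n u),
      (shares n order u).getD j 0 : ℕ) : ℚ) ≤ n w + Fintype.card P := by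
    rw [Nat.cast_sum]
    -- Each light node gives its ideal share plus at most 1. The ideal shares add up to at most `n
    -- w`, because the light nodes hold no more than the heavy ones.
    calc _ ≤ ∑ u ∈ Finset.univ.filter (fun u => ¬ IsHeavy n u),
          ((n w : ℚ) / (((heavyList n order).map n).sum : ℕ) * n u + 1) := by
          refine Finset.sum_le_sum fun u _ => ?_
          rw [← hj]
          exact proportional_getD_le _ _ _ _ _
      _ = (n w : ℚ) / (((heavyList n order).map n).sum : ℕ) *
            (∑ u ∈ Finset.univ.filter (fun u => ¬ IsHeavy n u), n u : ℕ) +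
          (Finset.univ.filter (fun u => ¬ IsHeavy n u)).card := by
          rw [Finset.sum_add_distrib, ← Finset.mul_sum, Finset.sum_const, Nat.cast_sum]
          simp
      _ ≤ (n w : ℚ) / (((heavyList n order).map n).sum : ℕ) *
            (((heavyList n order).map n).sum : ℕ) + Fintype.card P := by
          gcongr
          · exact sum_light_le_heavyList hnd hmem
          · exact Finset.card_le_univ _
      _ = _ := by rw [div_mul_cancel₀ _ hH.ne']
  have h2 : (∑ u ∈ Finset.univ.filter (fun u => ¬ IsHeavy n u),
      (shares n order u).getD j 0) ≤ n w + Fintype.card P := by exact_mod_cast h1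
  have h3 := hheavy.card_le hN
  rw [load, hj]
  omega

end Loads

/-! ## The data of the heavy nodes after the first round -/

section Store

variable {P : Type u} [Fintype P] {n : P → ℕ} {order : List P} {α : Type v} [LinearOrder α]
  {R : Finset α} {D : P → Finset α}

/-- What node `w` stores after the first round. -/
noncomputable def store (n : P → ℕ) (order : List P) (D : P → Finset α) (w : P) : Finset α :=
  D w ∪ received fun u => send₁ n order u (D u) w

theorem send₁_subset (w : P) (X : Finset α) (t : P) : send₁ n order w X t ⊆ X := by
  classical
  unfold send₁
  split_ifs
  · exact Finset.empty_subset _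
  · exact Finset.filter_subset _ _

/-- The elements sent to `t` have ranks in a single interval, since a list without repetitions
determines the index of `t`. -/
theorem card_send₁_le (hnd : order.Nodup) (w : P) (X : Finset α) {t : P} {j : ℕ}
    (hj : (heavyList n order)[j]? = some t) :
    (send₁ n order w X t).card ≤ if IsHeavy n w then 0 else (shares n order w).getD j 0 := by
  classical
  unfold send₁
  split_ifs with hw
  · simp
  · have hjk : j < (shares n order w).length := by
      rw [length_shares]
      exact (List.getElem?_eq_some_iff.1 hj).1
    have hs : ((shares n order w).take (j + 1)).sum =
        ((shares n order w).take j).sum + (shares n order w).getD j 0 := by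
      rw [List.sum_take_succ _ _ hjk, List.getD_eq_getElem _ _ hjk]
    refine (card_filter_rank_le (X := X) ((shares n order w).take j).sum
      ((shares n order w).take (j + 1)).sum _ (Finset.filter_subset _ _) ?_).trans (by omega)
    · intro x hx
      obtain ⟨-, i, hi, h1, h2⟩ := Finset.mem_filter.1 hx
      have hij : i = j := by
        obtain ⟨hi', hi⟩ := List.getElem?_eq_some_iff.1 hi
        obtain ⟨hj', hj⟩ := List.getElem?_eq_some_iff.1 hj
        exact (nodup_heavyList hnd).getElem_inj_iff.1 (hi.trans hj.symm)
      subst hij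
      exact ⟨h1, h2⟩

theorem card_received_send₁_le (hnd : order.Nodup) {t : P} {j : ℕ}
    (hj : (heavyList n order)[j]? = some t) :
    (received fun u => send₁ n order u (D u) t).card ≤
      ∑ w ∈ Finset.univ.filter (fun w => ¬ IsHeavy n w), (shares n order w).getD j 0 := by
  unfold received
  refine Finset.card_biUnion_le.trans ?_
  rw [Finset.sum_filter]
  refine Finset.sum_le_sum fun w _ => ?_
  refine (card_send₁_le hnd w (D w) hj).trans (le_of_eq ?_)
  split_ifs <;> rfl

theorem card_store_le_load (hnd : order.Nodup) (hD : IsPlacement R n D) {t : P} {j : ℕ}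
    (hj : (heavyList n order)[j]? = some t) : (store n order D t).card ≤ load n order j := by
  refine (Finset.card_union_le _ _).trans (add_le_add ?_ (card_received_send₁_le hnd hj))
  rw [hD.card]
  simp [List.getD_eq_getElem?_getD, hj]

theorem exists_index (hmem : ∀ w, w ∈ order) {t : P} (ht : IsHeavy n t) :
    ∃ j : ℕ, (heavyList n order)[j]? = some t :=
  List.mem_iff_getElem?.1 ((mem_heavyList hmem).2 ht)

theorem card_store_le [Nonempty P] (hnd : order.Nodup) (hmem : ∀ w, w ∈ order)
    (hN : 2 * Fintype.card P ^ 2 ≤ total n) (hD : IsPlacement R n D) {t : P}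
    (ht : IsHeavy n t) : (store n order D t).card ≤ 3 * n t := by
  obtain ⟨j, hj⟩ := exists_index hmem ht
  exact (card_store_le_load hnd hD hj).trans (load_le hnd hmem hN hj)

theorem store_subset (hD : IsPlacement R n D) (w : P) : store n order D w ⊆ R := by
  intro x hx
  rw [hD.union]
  rcases Finset.mem_union.1 hx with hx | hx
  · exact ⟨w, hx⟩
  · obtain ⟨u, -, hu⟩ := Finset.mem_biUnion.1 hx
    exact ⟨u, send₁_subset _ _ _ hu⟩

theorem card_eq_total (hD : IsPlacement R n D) : R.card = total n := by
  classical
  have h : R = Finset.univ.biUnion D := by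
    ext x
    simp [hD.union]
  rw [h, Finset.card_biUnion fun a _ b _ hab => hD.disjoint hab]
  exact Finset.sum_congr rfl fun w _ => hD.card w

/-- After the first round every element is stored at a heavy node. -/
theorem exists_mem_store [Nonempty P] (hnd : order.Nodup) (hmem : ∀ w, w ∈ order)
    (hN : 0 < total n) (hD : IsPlacement R n D) {x : α} (hx : x ∈ R) :
    ∃ t, IsHeavy n t ∧ x ∈ store n order D t := by
  classical
  obtain ⟨w, hw⟩ := (hD.union x).1 hx
  by_cases hh : IsHeavy n w
  · exact ⟨w, hh, Finset.mem_union_left _ hw⟩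
  · have hr : rank (D w) x < (shares n order w).sum := by
      rw [sum_shares hnd hmem hN, ← hD.card]
      exact rank_lt_card hw
    obtain ⟨i, hi, h1, h2⟩ := exists_take_sum_le_lt _ _ hr
    rw [length_shares] at hi
    refine ⟨(heavyList n order)[i], (mem_heavyList hmem).1 (List.getElem_mem _),
      Finset.mem_union_right _ (Finset.mem_biUnion.2 ⟨w, Finset.mem_univ _, ?_⟩)⟩
    unfold send₁
    rw [if_neg hh]
    exact Finset.mem_filter.2 ⟨hw, i, List.getElem?_eq_getElem _, h1, h2⟩

theorem total_le_sum_load [Nonempty P] (hnd : order.Nodup) (hmem : ∀ w, w ∈ order)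
    (hN : 0 < total n) (hD : IsPlacement R n D) :
    total n ≤ ∑ j ∈ Finset.range (heavyList n order).length, load n order j := by
  classical
  rw [← card_eq_total hD]
  have h : R ⊆ Finset.univ.biUnion fun j : Fin (heavyList n order).length =>
      store n order D (heavyList n order)[j] := by
    intro x hx
    obtain ⟨t, ht, hxt⟩ := exists_mem_store hnd hmem hN hD hx
    obtain ⟨j, hj, rfl⟩ := List.mem_iff_getElem.1 ((mem_heavyList hmem).2 ht)
    exact Finset.mem_biUnion.2 ⟨⟨j, hj⟩, Finset.mem_univ _, hxt⟩
  refine (Finset.card_le_card h).trans (Finset.card_biUnion_le.trans ?_)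
  rw [Finset.sum_range]
  exact Finset.sum_le_sum fun j _ => card_store_le_load hnd hD (List.getElem?_eq_getElem _)

/-- Needed for the last bucket, which has no upper splitter: all quotas together already account for
all the samples. -/
theorem card_le_sum_quota [Nonempty P] (hnd : order.Nodup) (hmem : ∀ w, w ∈ order)
    (hN : 0 < total n) (hD : IsPlacement R n D) :
    Fintype.card P ≤ ∑ j ∈ Finset.range (heavyList n order).length, quota n order j := by
  have hN' : (0 : ℚ) < total n := by exact_mod_cast hN
  have h1 : (total n : ℚ) ≤
      ∑ j ∈ Finset.range (heavyList n order).length, (load n order j : ℚ) := by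
    exact_mod_cast total_le_sum_load hnd hmem hN hD
  have h2 : (Fintype.card P : ℚ) ≤
      ∑ j ∈ Finset.range (heavyList n order).length, (quota n order j : ℚ) := by
    calc (Fintype.card P : ℚ) = (Fintype.card P : ℚ) / total n * total n := by
          rw [div_mul_cancel₀ _ hN'.ne']
      _ ≤ (Fintype.card P : ℚ) / total n *
          ∑ j ∈ Finset.range (heavyList n order).length, (load n order j : ℚ) := by gcongr
      _ ≤ _ := by
          rw [Finset.mul_sum]
          exact Finset.sum_le_sum fun j _ => Nat.le_ceil _
  exact_mod_cast h2

/-- Positive quotas make the partial sums strictly increasing, so different indices give different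
splitters. -/
theorem quota_pos [Nonempty P] (hmem : ∀ w, w ∈ order)
    (hN : 2 * Fintype.card P ^ 2 ≤ total n) {j : ℕ} (hj : j < (heavyList n order).length) :
    0 < quota n order j := by
  have hp : 0 < Fintype.card P := Fintype.card_pos
  have hN0 : 0 < total n := lt_of_lt_of_le (by positivity) hN
  have hheavy : IsHeavy n (heavyList n order)[j] := (mem_heavyList hmem).1 (List.getElem_mem _)
  have h : 0 < load n order j := by
    have := hheavy.card_le hN
    unfold load
    rw [List.getD_eq_getElem _ _ (by simpa using hj), List.getElem_map]
    omega
  exact Nat.ceil_pos.2 (by positivity)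

/-- The load contributes at most 3·`n t`, and rounding the quota up costs at most N/|V_C| ≤ 2·`n t`.
-/
theorem quota_le [Nonempty P] (hnd : order.Nodup) (hmem : ∀ w, w ∈ order)
    (hN : 2 * Fintype.card P ^ 2 ≤ total n) {j : ℕ} {t : P}
    (hj : (heavyList n order)[j]? = some t) :
    (total n : ℝ) / Fintype.card P * quota n order j ≤ 5 * n t := by
  have hp : (0 : ℚ) < Fintype.card P := by exact_mod_cast Fintype.card_pos
  have hN0 : (0 : ℚ) < total n := by
    exact_mod_cast lt_of_lt_of_le (by have := Fintype.card_pos (α := P); positivity) hN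
  have hheavy : IsHeavy n t := (mem_heavyList hmem).1 (List.mem_of_getElem? hj)
  have hl : (load n order j : ℚ) ≤ 3 * n t := by exact_mod_cast load_le hnd hmem hN hj
  have hq : (quota n order j : ℚ) < (Fintype.card P : ℚ) / total n * load n order j + 1 :=
    Nat.ceil_lt_add_one (by positivity)
  rw [IsHeavy, div_le_iff₀ (by positivity)] at hheavy
  have h : (total n : ℚ) / Fintype.card P * quota n order j ≤ 5 * n t := by
    calc (total n : ℚ) / Fintype.card P * quota n order j
        ≤ (total n : ℚ) / Fintype.card P *
          ((Fintype.card P : ℚ) / total n * load n order j + 1) := by gcongr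
      _ = load n order j + (total n : ℚ) / Fintype.card P := by field_simp
      _ ≤ 3 * n t + 2 * n t := by
          gcongr
          rw [div_le_iff₀ hp]
          linarith
      _ = _ := by ring
  have h' := (Rat.cast_le (K := ℝ)).2 h
  push_cast at h'
  exact h'

end Store

section Splitters

variable {P : Type u} [Fintype P] {n : P → ℕ} {order : List P} {α : Type v} [LinearOrder α]

/-! ## Splitters -/

theorem mem_splitters {S : Finset α} {x : α} : x ∈ splitters n order S ↔
    x ∈ S ∧ ∃ i, 1 ≤ i ∧ i < (heavyList n order).length ∧
      ∑ j ∈ Finset.range i, quota n order j < Fintype.card P ∧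
      rank S x + 1 =
        (∑ j ∈ Finset.range i, quota n order j) * ⌈(S.card : ℚ) / Fintype.card P⌉₊ := by
  classical
  unfold splitters
  exact Finset.mem_filter

theorem splitters_subset (S : Finset α) : splitters n order S ⊆ S :=
  fun _ hx => (mem_splitters.1 hx).1

theorem rank_succ_injOn (S : Finset α) : Set.InjOn (fun x => rank S x + 1) S :=
  fun _ hx _ hy h => rank_injOn hx hy (Nat.succ_injective h)

theorem card_splitters_le (S : Finset α) :
    (splitters n order S).card ≤ (heavyList n order).length - 1 := by
  classical
  rw [← Finset.card_image_of_injOn ((rank_succ_injOn S).mono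
    (by exact_mod_cast splitters_subset (n := n) (order := order) S)),
    ← Nat.card_Ico 1 (heavyList n order).length]
  refine le_trans (Finset.card_le_card ?_) (Finset.card_image_le (f := fun i =>
    (∑ j ∈ Finset.range i, quota n order j) * ⌈(S.card : ℚ) / Fintype.card P⌉₊))
  intro r hr
  obtain ⟨x, hx, rfl⟩ := Finset.mem_image.1 hr
  obtain ⟨-, i, h1, h2, -, h3⟩ := mem_splitters.1 hx
  exact Finset.mem_image.2 ⟨i, Finset.mem_Ico.2 ⟨h1, h2⟩, h3.symm⟩

theorem sum_quota_mono {i j : ℕ} (h : i ≤ j) :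
    ∑ l ∈ Finset.range i, quota n order l ≤ ∑ l ∈ Finset.range j, quota n order l :=
  Finset.sum_le_sum_of_subset (Finset.range_mono h)

theorem sum_quota_lt [Nonempty P] (hmem : ∀ w, w ∈ order)
    (hN : 2 * Fintype.card P ^ 2 ≤ total n) {i j : ℕ} (h : i < j)
    (hj : j ≤ (heavyList n order).length) :
    ∑ l ∈ Finset.range i, quota n order l < ∑ l ∈ Finset.range j, quota n order l := by
  refine lt_of_lt_of_le ?_ (sum_quota_mono (Nat.succ_le_of_lt h))
  rw [Finset.sum_range_succ]
  have := quota_pos hmem hN (h.trans_le hj)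
  omega

/-- If `y` came before the `j`-th splitter position, only the indices 1, …, j - 1 could yield
splitters that are at most `y`. -/
theorem le_rank_of_le_card (S : Finset α) (y : α) (j : ℕ)
    (h : j ≤ ((splitters n order S).filter (· ≤ y)).card) :
    (∑ l ∈ Finset.range j, quota n order l) * ⌈(S.card : ℚ) / Fintype.card P⌉₊ ≤
      rank S y + 1 := by
  classical
  by_contra! hc
  rcases Nat.eq_zero_or_pos j with rfl | hj
  · simp at hc
  have hsub : (splitters n order S).filter (· ≤ y) ⊆ S :=
    (Finset.filter_subset _ _).trans (splitters_subset S)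
  have h1 : ((splitters n order S).filter (· ≤ y)).card ≤ j - 1 := by
    rw [← Finset.card_image_of_injOn ((rank_succ_injOn S).mono (by exact_mod_cast hsub)),
      ← Nat.card_Ico 1 j]
    refine le_trans (Finset.card_le_card ?_) (Finset.card_image_le (f := fun i =>
      (∑ l ∈ Finset.range i, quota n order l) * ⌈(S.card : ℚ) / Fintype.card P⌉₊))
    intro r hr
    obtain ⟨x, hx, rfl⟩ := Finset.mem_image.1 hr
    obtain ⟨hxB, hxy⟩ := Finset.mem_filter.1 hx
    obtain ⟨-, i, hi1, hi2, -, hi3⟩ := mem_splitters.1 hxB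
    refine Finset.mem_image.2 ⟨i, Finset.mem_Ico.2 ⟨hi1, ?_⟩, hi3.symm⟩
    by_contra! hij
    have h2 := rank_mono (X := S) hxy
    have h3 := Nat.mul_le_mul_right ⌈(S.card : ℚ) / Fintype.card P⌉₊
      (sum_quota_mono (n := n) (order := order) hij)
    omega
  omega

/-- If `y` came after the position of index j + 1, then the positions of indices 1, …, j + 1 would
all be occupied by distinct samples at most `y`, giving j + 1 splitters. -/
theorem rank_le_of_card_le [Nonempty P] (hmem : ∀ w, w ∈ order)
    (hN : 2 * Fintype.card P ^ 2 ≤ total n)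
    (hq : Fintype.card P ≤ ∑ j ∈ Finset.range (heavyList n order).length, quota n order j)
    {S : Finset α} {y : α} (hy : y ∈ S) {j : ℕ} (hj : j < (heavyList n order).length)
    (h : ((splitters n order S).filter (· ≤ y)).card ≤ j) :
    rank S y + 1 ≤
      (∑ l ∈ Finset.range (j + 1), quota n order l) * ⌈(S.card : ℚ) / Fintype.card P⌉₊ := by
  classical
  by_contra! hc
  have hp : (0 : ℚ) < Fintype.card P := by exact_mod_cast Fintype.card_pos
  have hS : S.card ≤ Fintype.card P * ⌈(S.card : ℚ) / Fintype.card P⌉₊ := by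
    have h1 := Nat.le_ceil ((S.card : ℚ) / Fintype.card P)
    rw [div_le_iff₀ hp] at h1
    rw [mul_comm]
    exact_mod_cast h1
  have hr := rank_lt_card hy
  have hh : 0 < ⌈(S.card : ℚ) / Fintype.card P⌉₊ := by
    rcases Nat.eq_zero_or_pos ⌈(S.card : ℚ) / Fintype.card P⌉₊ with h0 | h0
    · rw [h0] at hS; omega
    · exact h0
  have hlt : ∑ l ∈ Finset.range (j + 1), quota n order l < Fintype.card P :=
    Nat.lt_of_mul_lt_mul_right (a := ⌈(S.card : ℚ) / Fintype.card P⌉₊) (by omega)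
  -- The quotas of all heavy nodes sum to at least |V_C|, so j + 1 is not the last index and does
  -- define a finite splitter.
  have hjk : j + 1 < (heavyList n order).length := by
    refine lt_of_le_of_ne hj fun he => ?_
    rw [he] at hlt
    omega
  have hsub : (splitters n order S).filter (· ≤ y) ⊆ S :=
    (Finset.filter_subset _ _).trans (splitters_subset S)
  have hinj : Set.InjOn (fun i => (∑ l ∈ Finset.range i, quota n order l) *
      ⌈(S.card : ℚ) / Fintype.card P⌉₊) (Finset.Icc 1 (j + 1) : Finset ℕ) := by
    intro a ha b hb hab
    rw [Finset.mem_coe, Finset.mem_Icc] at ha hb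
    have hab' := Nat.eq_of_mul_eq_mul_right hh hab
    rcases lt_trichotomy a b with h' | h' | h'
    · exact absurd hab' (sum_quota_lt hmem hN h' (by omega)).ne
    · exact h'
    · exact absurd hab' (sum_quota_lt hmem hN h' (by omega)).ne'
  have h1 : j + 1 ≤ ((splitters n order S).filter (· ≤ y)).card := by
    rw [← Finset.card_image_of_injOn ((rank_succ_injOn S).mono (by exact_mod_cast hsub))]
    calc j + 1 = (Finset.Icc 1 (j + 1)).card := by simp
      _ = _ := (Finset.card_image_of_injOn hinj).symm
      _ ≤ _ := Finset.card_le_card ?_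
    intro r hr
    obtain ⟨i, hi, rfl⟩ := Finset.mem_image.1 hr
    rw [Finset.mem_Icc] at hi
    have hij := sum_quota_mono (n := n) (order := order) hi.2
    have h2 := Nat.mul_le_mul_right ⌈(S.card : ℚ) / Fintype.card P⌉₊ hij
    have hpos : 0 < (∑ l ∈ Finset.range i, quota n order l) *
        ⌈(S.card : ℚ) / Fintype.card P⌉₊ :=
      Nat.mul_pos (lt_of_le_of_lt (Nat.zero_le _)
        (sum_quota_lt hmem hN (show 0 < i by omega) (by omega))) hh
    obtain ⟨x, hx, hxr⟩ := exists_rank_eq (X := S) (r := (∑ l ∈ Finset.range i,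
      quota n order l) * ⌈(S.card : ℚ) / Fintype.card P⌉₊ - 1) (by omega)
    refine Finset.mem_image.2 ⟨x, Finset.mem_filter.2 ⟨mem_splitters.2 ⟨hx, i, hi.1, by omega,
      by omega, by omega⟩, le_of_rank_le hy (by omega)⟩, by omega⟩
  omega

/-- The number of samples between two consecutive splitters. -/
theorem card_samples_le [Nonempty P] (hmem : ∀ w, w ∈ order)
    (hN : 2 * Fintype.card P ^ 2 ≤ total n)
    (hq : Fintype.card P ≤ ∑ j ∈ Finset.range (heavyList n order).length, quota n order j)
    (S : Finset α) {j : ℕ} (hj : j < (heavyList n order).length) :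
    (S.filter fun y => ((splitters n order S).filter (· ≤ y)).card = j).card ≤
      quota n order j * ⌈(S.card : ℚ) / Fintype.card P⌉₊ + 1 := by
  -- The value rank + 1 lies between two multiples of ⌈s/|V_C|⌉, both ends included, hence the extra
  -- 1. For `j = 0` the subtraction truncates to 0.
  refine (card_filter_rank_le (X := S)
    ((∑ l ∈ Finset.range j, quota n order l) * ⌈(S.card : ℚ) / Fintype.card P⌉₊ - 1)
    ((∑ l ∈ Finset.range (j + 1), quota n order l) * ⌈(S.card : ℚ) / Fintype.card P⌉₊) _
    (Finset.filter_subset _ _) ?_).trans ?_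
  · intro y hy
    obtain ⟨hyS, hyj⟩ := Finset.mem_filter.1 hy
    have h1 := le_rank_of_le_card (n := n) (order := order) S y j hyj.ge
    have h2 := rank_le_of_card_le hmem hN hq hyS hj hyj.le
    omega
  · rw [Finset.sum_range_succ, add_mul]
    omega

end Splitters

/-! ## The messages of the four rounds -/

section Messages

variable {P : Type u} [Fintype P] {n : P → ℕ} {order : List P} {α : Type v} [LinearOrder α]
  {R : Finset α} {D : P → Finset α} (ω : P × Fin (total n) → Bool)

open Classical in
/-- All the samples. -/
noncomputable def samples (n : P → ℕ) (order : List P) (D : P → Finset α)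
    (ω : P × Fin (total n) → Bool) : Finset α :=
  Finset.univ.biUnion fun w => if IsHeavy n w then
    (store n order D w).filter fun x =>
      ∃ i : Fin (total n), (i : ℕ) = rank (store n order D w) x ∧ ω (w, i) = true
  else ∅

theorem received_send₂ {t : P} (ht : (heavyList n order).head? = some t) :
    (received fun w => send₂ n order ω w (store n order D w) t) = samples n order D ω := by
  simp [received, samples, send₂, ht]

theorem message_zero (s t : P) : (weightedTeraSort n order α).message ω D 0 s t =
    send₁ n order s (D s) t := rfl

theorem message_one (s t : P) : (weightedTeraSort n order α).message ω D 1 s t =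
    send₂ n order ω s (store n order D s) t := rfl

open Classical in
theorem message_two (s t : P) : (weightedTeraSort n order α).message ω D 2 s t =
    if (heavyList n order).head? = some s ∧ IsHeavy n t then
      splitters n order (samples n order D ω) else ∅ := by
  classical
  have h : (weightedTeraSort n order α).message ω D 2 s t = send₃ n order s
    (received fun w => send₂ n order ω w (store n order D w) s) t := rfl
  rw [h, send₃]
  split_ifs with h1
  · rw [received_send₂ ω h1.1]
  · rfl

-- Since `v_1` exists and is the only sender of round 3, every heavy node works with exactly the
-- same set of splitters.
open Classical in
theorem message_three [Nonempty P] (hnd : order.Nodup) (hmem : ∀ w, w ∈ order)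
    (hN : 0 < total n) (s t : P) : (weightedTeraSort n order α).message ω D 3 s t =
    if IsHeavy n s then (store n order D s).filter fun x => (heavyList n order)[((splitters n
      order (samples n order D ω)).filter (· ≤ x)).card]? = some t else ∅ := by
  classical
  have h : (weightedTeraSort n order α).message ω D 3 s t = send₄ n order s (store n order D s)
    (received fun w => (weightedTeraSort n order α).message ω D 2 w s) t := rfl
  rw [h, send₄]
  split_ifs with hs
  · have hr : (received fun w => (weightedTeraSort n order α).message ω D 2 w s) =
        splitters n order (samples n order D ω) := by
      obtain ⟨v, hv⟩ : ∃ v, (heavyList n order).head? = some v := by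
        rw [← Option.isSome_iff_exists, List.isSome_head?]
        simpa using heavyList_ne_nil hnd hmem hN
      ext x
      simp only [received, message_two, hs, hv, Finset.mem_biUnion, Finset.mem_univ, true_and,
        and_true, Option.some.injEq]
      constructor
      · rintro ⟨a, ha⟩
        split_ifs at ha
        · exact ha
        · simp at ha
      · exact fun hx => ⟨v, by rwa [if_pos rfl]⟩
    rw [hr]
  · rfl

theorem mem_result [Nonempty P] (hnd : order.Nodup) (hmem : ∀ w, w ∈ order)
    (hN : 0 < total n) (hD : IsPlacement R n D) (t : P) (x : α) :
    x ∈ (weightedTeraSort n order α).result ω D t ↔ x ∈ R ∧ (heavyList n order)[((splitters n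
      order (samples n order D ω)).filter (· ≤ x)).card]? = some t := by
  classical
  have h : (weightedTeraSort n order α).result ω D t =
    (received fun w => (weightedTeraSort n order α).message ω D 3 w t).sort (· ≤ ·) := rfl
  rw [h, Finset.mem_sort, received, Finset.mem_biUnion]
  constructor
  · rintro ⟨w, -, hx⟩
    rw [message_three ω hnd hmem hN] at hx
    split_ifs at hx
    · obtain ⟨h1, h2⟩ := Finset.mem_filter.1 hx
      exact ⟨store_subset hD w h1, h2⟩
    · simp at hx
  · rintro ⟨h1, h2⟩
    obtain ⟨w, hw, hxw⟩ := exists_mem_store hnd hmem hN hD h1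
    refine ⟨w, Finset.mem_univ _, ?_⟩
    rw [message_three ω hnd hmem hN, if_pos hw]
    exact Finset.mem_filter.2 ⟨hxw, h2⟩

/-- Weighted TeraSort sorts, whatever the coins show. -/
theorem isSorted [Nonempty P] (hnd : order.Nodup) (hmem : ∀ w, w ∈ order)
    (hN : 0 < total n) (hD : IsPlacement R n D) :
    IsSorted order D ((weightedTeraSort n order α).result ω D) := by
  classical
  have hmr := mem_result ω hnd hmem hN hD
  refine ⟨List.pairwise_flatMap.2 ⟨fun t _ => ?_, ?_⟩, fun x => ?_⟩
  · exact Finset.sortedLT_sort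
      (received fun w => (weightedTeraSort n order α).message ω D 3 w t) |>.pairwise
  · have h : (heavyList n order).Pairwise fun s t =>
        ∀ x ∈ (weightedTeraSort n order α).result ω D s,
          ∀ y ∈ (weightedTeraSort n order α).result ω D t, x < y := by
      rw [List.pairwise_iff_getElem]
      intro i j hi hj hij x hx y hy
      rw [hmr] at hx hy
      obtain ⟨hx1, hx⟩ := List.getElem?_eq_some_iff.1 hx.2
      obtain ⟨hy1, hy⟩ := List.getElem?_eq_some_iff.1 hy.2
      rw [(nodup_heavyList hnd).getElem_inj_iff] at hx hy
      -- If `y ≤ x`, every splitter at most `y` is at most `x`, so the bucket of `y` is not to the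
      -- right of that of `x`.
      by_contra! hyx
      have : ((splitters n order (samples n order D ω)).filter (· ≤ y)).card ≤
          ((splitters n order (samples n order D ω)).filter (· ≤ x)).card :=
        Finset.card_le_card fun z hz => by
          rw [Finset.mem_filter] at hz ⊢
          exact ⟨hz.1, hz.2.trans hyx⟩
      omega
    rw [heavyList, List.pairwise_filter] at h
    refine h.imp fun {s t} hst x hx y hy => hst ?_ ?_ x hx y hy
    · simpa using (mem_heavyList hmem).1 (List.mem_of_getElem? ((hmr s x).1 hx).2)
    · simpa using (mem_heavyList hmem).1 (List.mem_of_getElem? ((hmr t y).1 hy).2)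
  · rw [List.mem_flatMap, ← hD.union]
    constructor
    · rintro ⟨t, -, ht⟩
      exact ((hmr t x).1 ht).1
    · intro hx
      -- At most k - 1 splitters exist, so every bucket number is a valid index into the k heavy
      -- nodes.
      have h1 := List.length_pos_of_ne_nil (heavyList_ne_nil (n := n) hnd hmem hN)
      have h2 : ((splitters n order (samples n order D ω)).filter (· ≤ x)).card <
          (heavyList n order).length := by
        have h3 := Finset.card_filter_le (splitters n order (samples n order D ω)) (· ≤ x)
        have h4 := card_splitters_le (n := n) (order := order) (samples n order D ω)
        omega
      exact ⟨_, hmem _, (hmr _ x).2 ⟨hx, List.getElem?_eq_getElem h2⟩⟩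

end Messages

section Bounds

variable {P : Type u} [Fintype P] {n : P → ℕ} {order : List P} {α : Type v} [LinearOrder α]
  {R : Finset α} {D : P → Finset α} {ω : P × Fin (total n) → Bool}

/-! ## The amount of data that a node sends and receives -/

/-- There are not too many samples, and every long interval of the data contains about its expected
number of samples. -/
def GoodSample (n : P → ℕ) (order : List P) (D : P → Finset α) (R : Finset α)
    (ω : P × Fin (total n) → Bool) : Prop :=
  ((samples n order D ω).card : ℝ) ≤
      24 * Fintype.card P * Real.log (Fintype.card P * total n) ∧
    ∀ x ∈ R, ∀ y ∈ R,
      4 * (total n : ℝ) / Fintype.card P ≤ (R.filter fun z => x ≤ z ∧ z ≤ y).card →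
      rho n * (R.filter fun z => x ≤ z ∧ z ≤ y).card ≤
        4 * ((samples n order D ω).filter fun z => x ≤ z ∧ z ≤ y).card

/-- N = 2 is excluded because 4 ln 2 > 2; then pN ≥ 3 > e makes the logarithm at least 1. -/
theorem size_bounds {p N : ℕ} (hp : 1 ≤ p) (hN : 2 ≤ N)
    (h : 4 * (p : ℝ) ^ 2 * Real.log (p * N) ≤ N) :
    3 ≤ N ∧ 1 ≤ Real.log (p * N) ∧ 2 * p ^ 2 ≤ N := by
  have hp' : (1 : ℝ) ≤ p := by exact_mod_cast hp
  have hN' : (2 : ℝ) ≤ N := by exact_mod_cast hN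
  have h3 : 3 ≤ N := by
    by_contra! hlt
    obtain rfl : N = 2 := by omega
    have h1 : Real.log 2 ≤ Real.log (p * (2 : ℕ)) :=
      Real.log_le_log two_pos (by push_cast; linarith)
    have h2 := Real.log_two_gt_d9
    push_cast at h h1
    nlinarith
  have h3' : (3 : ℝ) ≤ N := by exact_mod_cast h3
  have hl : 1 ≤ Real.log (p * N) := by
    rw [Real.le_log_iff_exp_le (by positivity)]
    have := Real.exp_one_lt_d9
    nlinarith
  refine ⟨h3, hl, ?_⟩
  have : (2 * p ^ 2 : ℝ) ≤ N := by nlinarith [sq_nonneg (p : ℝ)]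
  exact_mod_cast this

theorem IsHeavy.div_le [Nonempty P] {t : P} (ht : IsHeavy n t) :
    (total n : ℝ) / Fintype.card P ≤ 2 * n t := by
  have hp : (0 : ℚ) < Fintype.card P := by exact_mod_cast Fintype.card_pos
  rw [IsHeavy, div_le_iff₀ (by positivity)] at ht
  have h : (total n : ℚ) / Fintype.card P ≤ 2 * n t := by
    rw [div_le_iff₀ hp]; linarith
  have h' := (Rat.cast_le (K := ℝ)).2 h
  push_cast at h'
  exact h'

/-- Bounds what `v_1` receives in round 2: the size hypothesis turns 24 p ln(pN) into 6N/p, which is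
at most 12·`n t` for heavy `t`. -/
theorem card_samples_le_of_goodSample [Nonempty P]
    (hlog : 4 * (Fintype.card P : ℝ) ^ 2 * Real.log (Fintype.card P * total n) ≤ total n)
    (hω : GoodSample n order D R ω) {t : P} (ht : IsHeavy n t) :
    (samples n order D ω).card ≤ 12 * n t := by
  have hp : (0 : ℝ) < Fintype.card P := by exact_mod_cast Fintype.card_pos (α := P)
  have h1 := ht.div_le
  have h2 : 24 * Fintype.card P * Real.log (Fintype.card P * total n) ≤
      6 * ((total n : ℝ) / Fintype.card P) := by
    rw [mul_div_assoc', le_div_iff₀ hp]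
    linarith
  have h3 : ((samples n order D ω).card : ℝ) ≤ 12 * n t := by linarith [hω.1]
  exact_mod_cast h3

theorem card_splitters_le_of_isHeavy [Nonempty P] (hnd : order.Nodup)
    (hN : 2 * Fintype.card P ^ 2 ≤ total n) (S : Finset α) {t : P} (ht : IsHeavy n t) :
    (splitters n order S).card ≤ n t := by
  refine le_trans ?_ (ht.card_le hN)
  have h1 := card_splitters_le (n := n) (order := order) S
  have h2 := (nodup_heavyList (n := n) hnd).length_le_card
  omega

variable [Nonempty P] (hnd : order.Nodup) (hmem : ∀ w, w ∈ order) (hD : IsPlacement R n D)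
  (hN : 2 ≤ total n)
  (hlog : 4 * (Fintype.card P : ℝ) ^ 2 * Real.log (Fintype.card P * total n) ≤ total n)
include hnd hmem hD hN hlog

/-- The number of elements between two consecutive splitters. -/
theorem card_bucket_le (hω : GoodSample n order D R ω) {t : P} {j : ℕ}
    (hj : (heavyList n order)[j]? = some t) :
    (R.filter fun x => ((splitters n order (samples n order D ω)).filter (· ≤ x)).card = j).card
      ≤ 135 * n t := by
  obtain ⟨hN3, hl, hNp⟩ := size_bounds Fintype.card_pos hN hlog
  have hp : (0 : ℝ) < Fintype.card P := by exact_mod_cast Fintype.card_pos (α := P)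
  have hNpos : (0 : ℝ) < total n := by exact_mod_cast (by omega : 0 < total n)
  have ht : IsHeavy n t := (mem_heavyList hmem).1 (List.mem_of_getElem? hj)
  obtain ⟨hjk, -⟩ := List.getElem?_eq_some_iff.1 hj
  have hq := card_le_sum_quota hnd hmem (by omega : 0 < total n) hD
  set S := samples n order D ω with hS
  set J := R.filter fun x => ((splitters n order S).filter (· ≤ x)).card = j with hJ
  rcases J.eq_empty_or_nonempty with h0 | h0
  · simp [h0]
  -- The bucket is enclosed in the interval between its own extremes, which belong to `R`; so
  -- `GoodSample` only has to control intervals with end points in `R`.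
  set x := J.min' h0
  set y := J.max' h0
  obtain ⟨hxR, hxj⟩ := Finset.mem_filter.1 (J.min'_mem h0)
  obtain ⟨hyR, hyj⟩ := Finset.mem_filter.1 (J.max'_mem h0)
  have hJI : J.card ≤ (R.filter fun z => x ≤ z ∧ z ≤ y).card :=
    Finset.card_le_card fun z hz => Finset.mem_filter.2
      ⟨(Finset.mem_filter.1 hz).1, J.min'_le z hz, J.le_max' z hz⟩
  have hcard : ∀ {a b : α}, a ≤ b → ((splitters n order S).filter (· ≤ a)).card ≤
      ((splitters n order S).filter (· ≤ b)).card := fun hab =>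
    Finset.card_le_card fun z hz => by
      rw [Finset.mem_filter] at hz ⊢
      exact ⟨hz.1, hz.2.trans hab⟩
  have hSI : (S.filter fun z => x ≤ z ∧ z ≤ y).card ≤
      quota n order j * ⌈(S.card : ℚ) / Fintype.card P⌉₊ + 1 := by
    refine le_trans (Finset.card_le_card fun z hz => ?_) (card_samples_le hmem hNp hq S hjk)
    obtain ⟨hz, h1, h2⟩ := Finset.mem_filter.1 hz
    exact Finset.mem_filter.2 ⟨hz, le_antisymm ((hcard h2).trans hyj.le)
      (hxj.ge.trans (hcard h1))⟩
  have hnt := ht.div_le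
  suffices h : (J.card : ℝ) ≤ 135 * n t by exact_mod_cast h
  have hJI' : (J.card : ℝ) ≤ (R.filter fun z => x ≤ z ∧ z ≤ y).card := by exact_mod_cast hJI
  refine hJI'.trans ?_
  by_cases hlong : 4 * (total n : ℝ) / Fintype.card P ≤ (R.filter fun z => x ≤ z ∧ z ≤ y).card
  · have h1 := hω.2 x hxR y hyR hlong
    rw [← hS] at h1
    have hh : (⌈(S.card : ℚ) / Fintype.card P⌉₊ : ℝ) ≤
        24 * Real.log (Fintype.card P * total n) + 1 := by
      have h2 : (⌈(S.card : ℚ) / Fintype.card P⌉₊ : ℚ) < (S.card : ℚ) / Fintype.card P + 1 :=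
        Nat.ceil_lt_add_one (by positivity)
      have h3 := (Rat.cast_lt (K := ℝ)).2 h2
      push_cast at h3
      have h4 : (S.card : ℝ) / Fintype.card P ≤
          24 * Real.log (Fintype.card P * total n) := by
        rw [div_le_iff₀ hp]
        linarith [hω.1]
      linarith
    have hSI' : ((S.filter fun z => x ≤ z ∧ z ≤ y).card : ℝ) ≤
        quota n order j * ⌈(S.card : ℚ) / Fintype.card P⌉₊ + 1 := by exact_mod_cast hSI
    have hq1 : (1 : ℝ) ≤ quota n order j := by exact_mod_cast quota_pos hmem hNp hjk
    have hqn := quota_le hnd hmem hNp hj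
    set ℓ := Real.log (Fintype.card P * total n) with hℓ
    set I : ℝ := Nat.cast (R.filter fun z => x ≤ z ∧ z ≤ y).card
    -- With quota c ≥ 1 and ℓ ≥ 1 one has c(24ℓ + 1) + 1 ≤ 26cℓ.
    have h5 : 4 * ((S.filter fun z => x ≤ z ∧ z ≤ y).card : ℝ) ≤
        4 * (26 * (quota n order j * ℓ)) := by
      nlinarith [mul_le_mul_of_nonneg_left hh (by linarith : (0 : ℝ) ≤ quota n order j)]
    have h6 : ℓ * I = (total n : ℝ) / Fintype.card P * (rho n * I) / 4 := by
      rw [rho, ← hℓ]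
      field_simp
    -- The logarithm in the sampling rate cancels the one in the number of samples; 130 = 26 · 5,
    -- with the 5 from `quota_le`.
    have h7 : ℓ * I ≤ ℓ * (130 * n t) := by
      have h9 := h1.trans h5
      calc ℓ * I = (total n : ℝ) / Fintype.card P * (rho n * I) / 4 := h6
        _ ≤ (total n : ℝ) / Fintype.card P * (4 * (26 * (quota n order j * ℓ))) / 4 := by
            refine div_le_div_of_nonneg_right (mul_le_mul_of_nonneg_left h9 ?_) ?_ <;> positivity
        _ = 26 * ℓ * ((total n : ℝ) / Fintype.card P * quota n order j) := by ring
        _ ≤ 26 * ℓ * (5 * n t) := by gcongr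
        _ = _ := by ring
    have h8 := le_of_mul_le_mul_left h7 (by linarith)
    have : (0 : ℝ) ≤ n t := Nat.cast_nonneg _
    linarith
  -- A short interval has fewer than 4N/|V_C| ≤ 8·`n t` elements.
  · rw [not_le, mul_div_assoc] at hlong
    have : (0 : ℝ) ≤ n t := Nat.cast_nonneg _
    linarith

/-- Holds for all outcomes of the coins: a node sends parts of its store, except for the splitters,
which only a heavy node sends. Copies sent to several nodes count once in the union. -/
theorem card_sent_le {i : ℕ} (hi : i < 4) (s : P) :
    (Finset.univ.biUnion fun t => (weightedTeraSort n order α).message ω D i s t).card ≤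
      135 * n s := by
  classical
  obtain ⟨-, -, hNp⟩ := size_bounds Fintype.card_pos hN hlog
  have key : ∀ (X : Finset α) (c : ℕ), c ≤ 135 → X.card ≤ c * n s →
      (∀ t, (weightedTeraSort n order α).message ω D i s t ⊆ X) →
      (Finset.univ.biUnion fun t => (weightedTeraSort n order α).message ω D i s t).card ≤
        135 * n s := fun X c hc hX h =>
    (Finset.card_le_card (Finset.biUnion_subset.2 fun t _ => h t)).trans
      (hX.trans (Nat.mul_le_mul_right _ hc))
  have hempty := key ∅ 0 (by norm_num) (by simp)
  interval_cases i
  · refine key (D s) 1 (by norm_num) (by rw [hD.card, one_mul]) fun t => ?_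
    rw [message_zero]
    exact send₁_subset _ _ _
  · by_cases hs : IsHeavy n s
    · refine key (store n order D s) 3 (by norm_num) (card_store_le hnd hmem hNp hD hs)
        fun t => ?_
      rw [message_one, send₂]
      split_ifs
      · exact Finset.filter_subset _ _
      · exact Finset.empty_subset _
    · refine hempty fun t => ?_
      rw [message_one, send₂, if_neg (by tauto)]
  · by_cases hs : (heavyList n order).head? = some s
    · refine key (splitters n order (samples n order D ω)) 1 (by norm_num) ?_ fun t => ?_
      · rw [one_mul]
        exact card_splitters_le_of_isHeavy hnd hNp _
          ((mem_heavyList hmem).1 (List.mem_of_head? hs))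
      · rw [message_two]
        split_ifs
        · exact subset_rfl
        · exact Finset.empty_subset _
    · refine hempty fun t => ?_
      rw [message_two, if_neg (by tauto)]
  · by_cases hs : IsHeavy n s
    · refine key (store n order D s) 3 (by norm_num) (card_store_le hnd hmem hNp hD hs)
        fun t => ?_
      rw [message_three ω hnd hmem (by omega)]
      split_ifs
      exact Finset.filter_subset _ _
    · refine hempty fun t => ?_
      rw [message_three ω hnd hmem (by omega), if_neg hs]

/-- Light nodes receive nothing. For heavy nodes the factors in the four rounds are 3, 12, 1 and
135; only the second and the last use the good sample. -/
theorem card_received_le (hω : GoodSample n order D R ω) {i : ℕ} (hi : i < 4) (t : P) :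
    (Finset.univ.biUnion fun s => (weightedTeraSort n order α).message ω D i s t).card ≤
      135 * n t := by
  classical
  obtain ⟨-, -, hNp⟩ := size_bounds Fintype.card_pos hN hlog
  have key : ∀ (X : Finset α) (c : ℕ), c ≤ 135 → X.card ≤ c * n t →
      (∀ s, (weightedTeraSort n order α).message ω D i s t ⊆ X) →
      (Finset.univ.biUnion fun s => (weightedTeraSort n order α).message ω D i s t).card ≤
        135 * n t := fun X c hc hX h =>
    (Finset.card_le_card (Finset.biUnion_subset.2 fun s _ => h s)).trans
      (hX.trans (Nat.mul_le_mul_right _ hc))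
  have hempty := key ∅ 0 (by norm_num) (by simp)
  by_cases ht : IsHeavy n t
  · interval_cases i
    · refine key (store n order D t) 3 (by norm_num) (card_store_le hnd hmem hNp hD ht)
        fun s x hx => ?_
      rw [message_zero] at hx
      exact Finset.mem_union_right _ (Finset.mem_biUnion.2 ⟨s, Finset.mem_univ _, hx⟩)
    · refine key (samples n order D ω) 12 (by norm_num)
        (card_samples_le_of_goodSample hlog hω ht) fun s => ?_
      rw [message_one]
      by_cases hv : (heavyList n order).head? = some t
      · rw [← received_send₂ ω hv]
        exact Finset.subset_biUnion_of_mem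
          (fun s => send₂ n order ω s (store n order D s) t) (Finset.mem_univ s)
      · rw [send₂, if_neg (by tauto)]
        exact Finset.empty_subset _
    · refine key (splitters n order (samples n order D ω)) 1 (by norm_num) ?_ fun s => ?_
      · rw [one_mul]
        exact card_splitters_le_of_isHeavy hnd hNp _ ht
      · rw [message_two]
        split_ifs
        · exact subset_rfl
        · exact Finset.empty_subset _
    · obtain ⟨j, hj⟩ := exists_index (order := order) hmem ht
      refine key _ 135 le_rfl (card_bucket_le hnd hmem hD hN hlog hω hj) fun s x hx => ?_
      rw [message_three ω hnd hmem (by omega)] at hx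
      split_ifs at hx
      · obtain ⟨h1, h2⟩ := Finset.mem_filter.1 hx
        refine Finset.mem_filter.2 ⟨store_subset hD s h1, ?_⟩
        obtain ⟨h3, h4⟩ := List.getElem?_eq_some_iff.1 h2
        obtain ⟨h5, h6⟩ := List.getElem?_eq_some_iff.1 hj
        exact (nodup_heavyList hnd).getElem_inj_iff.1 (h4.trans h6.symm)
      · simp at hx
  · have hne : ∀ j : ℕ, (heavyList n order)[j]? ≠ some t := fun j hj =>
      ht ((mem_heavyList hmem).1 (List.mem_of_getElem? hj))
    refine hempty fun s => ?_
    interval_cases i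
    · rw [message_zero, send₁]
      split_ifs
      · exact subset_rfl
      · intro x hx
        obtain ⟨-, i, hi, -⟩ := Finset.mem_filter.1 hx
        exact absurd hi (hne i)
    · rw [message_one, send₂, if_neg]
      rintro ⟨-, h⟩
      exact ht ((mem_heavyList hmem).1 (List.mem_of_head? h))
    · rw [message_two, if_neg (by tauto)]
    · rw [message_three ω hnd hmem (by omega)]
      split_ifs
      · intro x hx
        exact absurd (Finset.mem_filter.1 hx).2 (hne _)
      · exact subset_rfl

end Bounds

section Probability

variable {P : Type u} [Fintype P] {n : P → ℕ} {order : List P} {α : Type v} [LinearOrder α]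
  {R : Finset α} {D : P → Finset α}

/-! ## The probability of a good sample -/

/-- The number of samples is at most the number of coins that show `true` among those that are
used. -/
theorem exists_card_samples_le_heads [Nonempty P] (hnd : order.Nodup) (hmem : ∀ w, w ∈ order)
    (hN : 2 * Fintype.card P ^ 2 ≤ total n) (hD : IsPlacement R n D) :
    ∃ T : Finset (P × Fin (total n)), T.card ≤ 3 * total n ∧
      ∀ ω, (samples n order D ω).card ≤ heads T ω := by
  classical
  -- The coins at positions below the store sizes of the heavy nodes; the 3 comes from the bound
  -- 3·`n w` on each store.
  refine ⟨Finset.univ.filter fun q => IsHeavy n q.1 ∧ (q.2 : ℕ) < (store n order D q.1).card,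
    ?_, fun ω => ?_⟩
  · calc _ ≤ ((Finset.univ.filter (IsHeavy n)).sigma
          fun w => Finset.range (store n order D w).card).card := by
          refine Finset.card_le_card_of_injOn (fun q => ⟨q.1, q.2⟩) (fun q hq => ?_) ?_
          · simpa using hq
          · rintro ⟨w, i⟩ - ⟨w', i'⟩ - h
            simp only [Sigma.mk.injEq, heq_eq_eq] at h
            exact Prod.ext h.1 (Fin.ext h.2)
      _ = ∑ w ∈ Finset.univ.filter (IsHeavy n), (store n order D w).card := by simp
      _ ≤ ∑ w ∈ Finset.univ.filter (IsHeavy n), 3 * n w :=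
          Finset.sum_le_sum fun w hw =>
            card_store_le hnd hmem hN hD (Finset.mem_filter.1 hw).2
      _ ≤ ∑ w, 3 * n w := Finset.sum_le_sum_of_subset (Finset.filter_subset _ _)
      _ = 3 * total n := by rw [← Finset.mul_sum]; rfl
  · refine Finset.card_le_card_of_forall_subsingleton
      (fun x q => x ∈ store n order D q.1 ∧ (q.2 : ℕ) = rank (store n order D q.1) x) ?_ ?_
    · intro x hx
      obtain ⟨w, -, hx⟩ := Finset.mem_biUnion.1 hx
      split_ifs at hx with hw
      · obtain ⟨hxw, i, hi, hω⟩ := Finset.mem_filter.1 hx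
        refine ⟨(w, i), ?_, hxw, hi⟩
        simp only [Finset.mem_filter, Finset.mem_univ, true_and]
        exact ⟨⟨hw, hi ▸ rank_lt_card hxw⟩, hω⟩
      · simp at hx
    · rintro ⟨w, i⟩ - x ⟨-, hx, hx'⟩ y ⟨-, hy, hy'⟩
      exact rank_injOn hx hy (hx'.symm.trans hy')

/-- The number of samples in a part of the data is at least the number of coins that show `true`
among as many as the part has elements. -/
theorem exists_heads_le_card_samples [Nonempty P] (hnd : order.Nodup) (hmem : ∀ w, w ∈ order)
    (hN : 0 < total n) (hD : IsPlacement R n D) (p : α → Prop) [DecidablePred p] :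
    ∃ T : Finset (P × Fin (total n)), T.card = (R.filter p).card ∧
      ∀ ω, heads T ω ≤ ((samples n order D ω).filter p).card := by
  classical
  -- For each element one heavy node storing it is chosen, with the coin at its rank there. The coin
  -- determines the element, so distinct elements get distinct coins.
  have hex : ∀ x : R, ∃ q : P × Fin (total n), IsHeavy n q.1 ∧ (x : α) ∈ store n order D q.1 ∧
      (q.2 : ℕ) = rank (store n order D q.1) (x : α) := by
    intro x
    obtain ⟨t, ht, hx⟩ := exists_mem_store hnd hmem hN hD x.2
    refine ⟨(t, ⟨rank (store n order D t) x, ?_⟩), ht, hx, rfl⟩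
    rw [← card_eq_total hD]
    exact (rank_lt_card hx).trans_le (Finset.card_le_card (store_subset hD t))
  choose φ hφ using hex
  have hinj : Function.Injective φ := by
    intro x y hxy
    have hx := hφ x
    have hy := hφ y
    rw [hxy] at hx
    exact Subtype.ext (rank_injOn hx.2.1 hy.2.1 (hx.2.2.symm.trans hy.2.2))
  refine ⟨((R.filter p).subtype (· ∈ R)).image φ, ?_, fun ω => ?_⟩
  · rw [Finset.card_image_of_injective _ hinj, Finset.card_subtype,
      Finset.filter_true_of_mem fun x hx => (Finset.mem_filter.1 hx).1]
  · refine Finset.card_le_card_of_forall_subsingleton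
      (fun q x => ∃ h : x ∈ R, φ ⟨x, h⟩ = q) ?_ ?_
    · intro q hq
      obtain ⟨hq, hω⟩ := Finset.mem_filter.1 hq
      obtain ⟨⟨x, hxR⟩, hx, rfl⟩ := Finset.mem_image.1 hq
      have hx := (Finset.mem_filter.1 (Finset.mem_subtype.1 hx)).2
      obtain ⟨h1, h2, h3⟩ := hφ ⟨x, hxR⟩
      refine ⟨x, Finset.mem_filter.2 ⟨Finset.mem_biUnion.2
        ⟨(φ ⟨x, hxR⟩).1, Finset.mem_univ _, ?_⟩, hx⟩, hxR, rfl⟩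
      rw [if_pos h1]
      exact Finset.mem_filter.2 ⟨h2, _, h3, hω⟩
    · rintro x - q ⟨-, h, rfl⟩ q' ⟨-, h', rfl⟩
      rfl

theorem law_eq : (weightedTeraSort n order α).law =
    coins (P × Fin (total n)) (Set.projIcc 0 1 zero_le_one (rho n)) := rfl

variable [Nonempty P] (hnd : order.Nodup) (hmem : ∀ w, w ∈ order) (hD : IsPlacement R n D)
  (hN : 2 ≤ total n)
  (hlog : 4 * (Fintype.card P : ℝ) ^ 2 * Real.log (Fintype.card P * total n) ≤ total n)

include hN hlog in
theorem rho_mem : rho n ∈ Set.Icc (0 : ℝ) 1 := by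
  obtain ⟨hN3, hl, hNp⟩ := size_bounds Fintype.card_pos hN hlog
  have hp : (1 : ℝ) ≤ Fintype.card P := by exact_mod_cast Fintype.card_pos (α := P)
  have hNpos : (0 : ℝ) < total n := by exact_mod_cast (by omega : 0 < total n)
  rw [rho]
  refine ⟨by positivity, ?_⟩
  rw [mul_div_assoc', div_mul_eq_mul_div, div_le_one hNpos]
  nlinarith

include hnd hmem hD hN hlog

theorem law_many_samples_le :
    (weightedTeraSort n order α).law {ω | ¬ ((samples n order D ω).card : ℝ) ≤
      24 * Fintype.card P * Real.log (Fintype.card P * total n)} ≤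
      ENNReal.ofReal (1 / (total n : ℝ) ^ 2) := by
  obtain ⟨hN3, hl, hNp⟩ := size_bounds Fintype.card_pos hN hlog
  have hp : (1 : ℝ) ≤ Fintype.card P := by exact_mod_cast Fintype.card_pos (α := P)
  have hNpos : (0 : ℝ) < total n := by exact_mod_cast (by omega : 0 < total n)
  obtain ⟨T, hT, hST⟩ := exists_card_samples_le_heads hnd hmem hNp hD
  have hrho := rho_mem hN hlog
  have h := measure_le_exp_mul_heads (Set.projIcc 0 1 zero_le_one (rho n)) T 1
    (24 * Fintype.card P * Real.log (Fintype.card P * total n))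
  rw [law_eq]
  refine (measure_mono fun ω hω => ?_).trans (h.trans (ENNReal.ofReal_le_ofReal ?_))
  · have h1 : ((samples n order D ω).card : ℝ) ≤ heads T ω := by exact_mod_cast hST ω
    have h2 := not_le.1 hω
    change (_ : ℝ) ≤ _
    linarith
  · rw [Set.projIcc_of_mem zero_le_one hrho]
    have hT' : (T.card : ℝ) ≤ 3 * total n := by exact_mod_cast hT
    -- Here 21 = 1.75 · 4 · 3. Against the threshold 24 this leaves an exponent of at most -3 p
    -- ln(pN), more than enough for N⁻².
    have h1 : (Real.exp 1 - 1) * rho n * T.card ≤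
        21 * (Fintype.card P * Real.log (Fintype.card P * total n)) := by
      have he : Real.exp 1 - 1 ≤ 1.75 := by linarith [Real.exp_one_lt_d9]
      have hr0 := hrho.1
      calc (Real.exp 1 - 1) * rho n * T.card ≤ 1.75 * rho n * (3 * total n) := by gcongr
        _ = _ := by rw [rho]; field_simp; ring
    have h2 : Real.log (total n) ≤ Real.log (Fintype.card P * total n) :=
      Real.log_le_log hNpos (by nlinarith)
    have h3 : Real.log (Fintype.card P * total n) ≤
        Fintype.card P * Real.log (Fintype.card P * total n) := by nlinarith
    calc _ ≤ Real.exp (-(2 * Real.log (total n))) := by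
          refine Real.exp_le_exp.2 ?_
          dsimp only
          linarith
      _ = _ := by
          rw [Real.exp_neg, one_div, show (2 : ℝ) = (2 : ℕ) by norm_num, Real.exp_nat_mul,
            Real.exp_log hNpos]

theorem law_sparse_interval_le (x y : α) :
    (weightedTeraSort n order α).law {ω | ¬ (4 * (total n : ℝ) / Fintype.card P ≤
      (R.filter fun z => x ≤ z ∧ z ≤ y).card → rho n * (R.filter fun z => x ≤ z ∧ z ≤ y).card ≤
        4 * ((samples n order D ω).filter fun z => x ≤ z ∧ z ≤ y).card)} ≤
      ENNReal.ofReal (1 / (total n : ℝ) ^ 4) := by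
  obtain ⟨hN3, hl, hNp⟩ := size_bounds Fintype.card_pos hN hlog
  have hp : (1 : ℝ) ≤ Fintype.card P := by exact_mod_cast Fintype.card_pos (α := P)
  have hNpos : (0 : ℝ) < total n := by exact_mod_cast (by omega : 0 < total n)
  by_cases hI : 4 * (total n : ℝ) / Fintype.card P ≤ (R.filter fun z => x ≤ z ∧ z ≤ y).card
  swap
  · simp [hI]
  obtain ⟨T, hT, hST⟩ := exists_heads_le_card_samples hnd hmem (by omega : 0 < total n) hD
    (fun z => x ≤ z ∧ z ≤ y)
  have hrho := rho_mem hN hlog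
  have h := measure_le_exp_mul_heads (Set.projIcc 0 1 zero_le_one (rho n)) T (-1)
    (-(rho n * T.card / 4))
  rw [law_eq]
  rw [← hT] at hI ⊢
  refine (measure_mono fun ω hω => ?_).trans (h.trans (ENNReal.ofReal_le_ofReal ?_))
  · have h1 : (heads T ω : ℝ) ≤ ((samples n order D ω).filter fun z => x ≤ z ∧ z ≤ y).card := by
      exact_mod_cast hST ω
    have hω' : ¬ (4 * (total n : ℝ) / Fintype.card P ≤ T.card → rho n * T.card ≤
        4 * ((samples n order D ω).filter fun z => x ≤ z ∧ z ≤ y).card) := hω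
    push Not at hω'
    change (_ : ℝ) ≤ _
    linarith [hω'.2]
  · rw [Set.projIcc_of_mem zero_le_one hrho]
    -- The Chernoff exponent is then at most (-1/2 + 1/4)·ρ|T|, and ρ|T| ≥ 16 ln(pN) on a long
    -- interval; this gives N⁻⁴.
    have he : Real.exp (-1) ≤ 1 / 2 := by
      rw [Real.exp_neg, one_div]
      exact inv_anti₀ two_pos (by linarith [Real.add_one_le_exp (1 : ℝ)])
    have h1 : 16 * Real.log (Fintype.card P * total n) ≤ rho n * T.card := by
      have hr0 := hrho.1
      calc 16 * Real.log (Fintype.card P * total n)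
          = rho n * (4 * (total n : ℝ) / Fintype.card P) := by rw [rho]; field_simp; ring
        _ ≤ _ := by gcongr
    have h2 : Real.log (total n) ≤ Real.log (Fintype.card P * total n) :=
      Real.log_le_log hNpos (by nlinarith)
    have h3 : 0 ≤ rho n * T.card := mul_nonneg hrho.1 (Nat.cast_nonneg _)
    calc _ ≤ Real.exp (-(4 * Real.log (total n))) := by
          refine Real.exp_le_exp.2 ?_
          dsimp only
          nlinarith
      _ = _ := by
          rw [Real.exp_neg, one_div, show (4 : ℝ) = (4 : ℕ) by norm_num, Real.exp_nat_mul,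
            Real.exp_log hNpos]

/-- Union bound: N⁻² for too many samples plus N² pairs of end points at N⁻⁴ each, and 2/N² ≤ 1/N.
-/
theorem le_law_goodSample : 1 - 1 / (R.card : ℝ≥0∞) ≤
    (weightedTeraSort n order α).law {ω | GoodSample n order D R ω} := by
  classical
  have hNpos : (0 : ℝ) < total n := by exact_mod_cast (by omega : 0 < total n)
  have hcover : (Set.univ : Set (P × Fin (total n) → Bool)) ⊆
      {ω | GoodSample n order D R ω} ∪
      ({ω | ¬ ((samples n order D ω).card : ℝ) ≤
        24 * Fintype.card P * Real.log (Fintype.card P * total n)} ∪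
      ⋃ q ∈ R ×ˢ R, {ω | ¬ (4 * (total n : ℝ) / Fintype.card P ≤
        (R.filter fun z => q.1 ≤ z ∧ z ≤ q.2).card →
          rho n * (R.filter fun z => q.1 ≤ z ∧ z ≤ q.2).card ≤
          4 * ((samples n order D ω).filter fun z => q.1 ≤ z ∧ z ≤ q.2).card)}) := by
    intro ω _
    by_contra hc
    simp only [Set.mem_union, not_or, Set.mem_iUnion, not_exists] at hc
    obtain ⟨h1, h2, h3⟩ := hc
    exact h1 ⟨not_not.1 h2, fun x hx y hy =>
      not_not.1 (h3 (x, y) (Finset.mk_mem_product hx hy))⟩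
  have h1 : (1 : ℝ≥0∞) ≤ (weightedTeraSort n order α).law {ω | GoodSample n order D R ω} +
      1 / (R.card : ℝ≥0∞) := by
    calc (1 : ℝ≥0∞) = (weightedTeraSort n order α).law Set.univ := measure_univ.symm
      _ ≤ _ := measure_mono hcover
      _ ≤ _ := measure_union_le _ _
      _ ≤ _ := by
        refine add_le_add_right ((measure_union_le _ _).trans ((add_le_add
          (law_many_samples_le hnd hmem hD hN hlog) ((measure_biUnion_finset_le _ _).trans
          (Finset.sum_le_sum fun q _ =>
            law_sparse_interval_le hnd hmem hD hN hlog q.1 q.2))).trans ?_)) _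
        rw [Finset.sum_const, Finset.card_product, card_eq_total hD, nsmul_eq_mul,
          ← ENNReal.ofReal_natCast, ← ENNReal.ofReal_mul (by positivity),
          ← ENNReal.ofReal_add (by positivity) (by positivity), ← ENNReal.ofReal_natCast,
          ← ENNReal.ofReal_one, ← ENNReal.ofReal_div_of_pos hNpos]
        refine ENNReal.ofReal_le_ofReal ?_
        have h2 : (2 : ℝ) ≤ total n := by exact_mod_cast hN
        push_cast
        rw [show 1 / (total n : ℝ) ^ 2 + (total n : ℝ) * total n * (1 / (total n : ℝ) ^ 4) =
          2 / (total n : ℝ) ^ 2 by field_simp; ring, div_le_div_iff₀ (by positivity) hNpos]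
        nlinarith
  exact tsub_le_iff_right.2 h1

end Probability

end WTS

/-! ### Weighted TeraSort against the lower bound -/

namespace TreeNetwork

variable {V : Type u} (net : TreeNetwork V) {α : Type v} [LinearOrder α]

theorem sortsWithCost_of_le {A : Algorithm net.Node α} {order : List net.Node}
    {D : net.Node → Finset α} {K p : ℝ≥0∞} (hp : p ≤ 0) : net.SortsWithCost A order D K p :=
  ⟨∅, MeasurableSet.empty, by simpa using hp, by simp⟩

theorem SortsWithCost.mono {A : Algorithm net.Node α} {order : List net.Node}
    {D : net.Node → Finset α} {K K' p : ℝ≥0∞} (h : net.SortsWithCost A order D K p)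
    (hK : K ≤ K') : net.SortsWithCost A order D K' p := by
  obtain ⟨E, h1, h2, h3⟩ := h
  exact ⟨E, h1, h2, fun ω hω => ⟨(h3 ω hω).1, (h3 ω hω).2.trans hK⟩⟩

/-- The cost of weighted TeraSort in terms of the lower bound. -/
theorem weightedTeraSort_sortsWithCost {root : V} {order : List net.Node}
    (ho : net.IsTraversal root order) {R : Finset α} {n : net.Node → ℕ} {D : net.Node → Finset α}
    (hD : IsPlacement R n D)
    (hlog : 4 * (net.compute.card : ℝ) ^ 2 * Real.log (net.compute.card * R.card) ≤ R.card)
    (hR : 2 ≤ R.card) :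
    net.SortsWithCost (weightedTeraSort n order α) order D (540 * net.lowerBound n)
      (1 - 1 / (R.card : ℝ≥0∞)) := by
  have hcard : Fintype.card net.Node = net.compute.card := Fintype.card_coe _
  have hN := hR
  rw [WTS.card_eq_total hD] at hN
  have hlog' := hlog
  rw [WTS.card_eq_total hD, ← hcard] at hlog'
  have : Nonempty net.Node := by
    obtain ⟨x, hx⟩ := Finset.card_pos.1 (by omega : 0 < R.card)
    obtain ⟨w, -⟩ := (hD.union x).1 hx
    exact ⟨w⟩
  refine ⟨{ω | WTS.GoodSample n order D R ω}, ?_,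
    WTS.le_law_goodSample ho.1 ho.2.1 hD hN hlog', fun ω hω =>
    ⟨WTS.isSorted ω ho.1 ho.2.1 (by omega) hD, ?_⟩⟩
  · change MeasurableSet (α := net.Node × Fin (WTS.total n) → Bool) _
    exact (Set.toFinite _).measurableSet
  · calc net.cost (weightedTeraSort n order α) ω D
        ≤ ∑ i ∈ Finset.range 4, ((135 : ℕ) : ℝ≥0∞) * net.lowerBound n := by
          refine Finset.sum_le_sum fun i hi => ?_
          have hi := Finset.mem_range.1 hi
          exact net.roundCost_le _ _ _ _ _ _
            (WTS.card_sent_le ho.1 ho.2.1 hD hN hlog' hi)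
            (WTS.card_received_le ho.1 ho.2.1 hD hN hlog' hω hi)
      _ = 540 * net.lowerBound n := by
          rw [Finset.sum_const, Finset.card_range, nsmul_eq_mul, ← mul_assoc]
          norm_num

end TreeNetwork

/-! ## The lower bound -/

theorem IsSorted.lt_of_append {P : Type u} {α : Type v} [LinearOrder α] {l l' : List P}
    {D : P → Finset α} {Z : P → List α} (h : IsSorted (l ++ l') D Z) {s t : P} (hs : s ∈ l)
    (ht : t ∈ l') {x y : α} (hx : x ∈ Z s) (hy : y ∈ Z t) : x < y := by
  have h1 := h.1
  rw [List.flatMap_append, List.pairwise_append] at h1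
  exact h1.2.2 x (List.mem_flatMap.2 ⟨s, hs, hx⟩) y (List.mem_flatMap.2 ⟨t, ht, hy⟩)

/-- A set can be divided into parts of given sizes. -/
theorem exists_division {ι : Type u} {α : Type v} [DecidableEq α] (n : ι → ℕ) (s : Finset ι)
    (T : Finset α) (hT : T.card = ∑ w ∈ s, n w) :
    ∃ F : ι → Finset α, (∀ w ∈ s, (F w).card = n w) ∧ (∀ w, w ∉ s → F w = ∅) ∧
      (Pairwise fun a b => Disjoint (F a) (F b)) ∧ ∀ x, x ∈ T ↔ ∃ w, x ∈ F w := by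
  classical
  induction s using Finset.induction_on generalizing T with
  | empty =>
    refine ⟨fun _ => ∅, by simp, by simp, fun _ _ _ => by simp, ?_⟩
    simp only [Finset.sum_empty, Finset.card_eq_zero] at hT
    simp [hT]
  | insert w s hw ih =>
    rw [Finset.sum_insert hw] at hT
    obtain ⟨U, hU, hUc⟩ := Finset.exists_subset_card_eq (show n w ≤ T.card by omega)
    obtain ⟨F, h1, h2, h3, h4⟩ := ih (T \ U) (by rw [Finset.card_sdiff_of_subset hU]; omega)
    have hFT : ∀ v, Disjoint U (F v) := fun v => Finset.disjoint_right.2 fun x hx =>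
      (Finset.mem_sdiff.1 ((h4 x).2 ⟨v, hx⟩)).2
    refine ⟨Function.update F w U, fun v hv => ?_, fun v hv => ?_, fun c d hcd => ?_, fun x => ?_⟩
    · rcases eq_or_ne v w with rfl | hvw
      · simpa using hUc
      · rw [Function.update_of_ne hvw]
        exact h1 v (Finset.mem_of_mem_insert_of_ne hv hvw)
    · rw [Finset.mem_insert, not_or] at hv
      rw [Function.update_of_ne hv.1]
      exact h2 v hv.2
    · change Disjoint (Function.update F w U c) (Function.update F w U d)
      by_cases hc : c = w
      · subst hc
        rw [Function.update_self, Function.update_of_ne (Ne.symm hcd)]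
        exact hFT d
      · rw [Function.update_of_ne hc]
        by_cases hd : d = w
        · subst hd
          rw [Function.update_self]
          exact (hFT c).symm
        · rw [Function.update_of_ne hd]
          exact h3 hcd
    · constructor
      · intro hx
        by_cases hxU : x ∈ U
        · exact ⟨w, by simpa using hxU⟩
        · obtain ⟨v, hv⟩ := (h4 x).1 (Finset.mem_sdiff.2 ⟨hx, hxU⟩)
          refine ⟨v, ?_⟩
          rwa [Function.update_of_ne]
          rintro rfl
          simp [h2 v hw] at hv
      · rintro ⟨v, hv⟩
        by_cases hvw : v = w
        · subst hvw
          rw [Function.update_self] at hv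
          exact hU hv
        · rw [Function.update_of_ne hvw] at hv
          exact (Finset.mem_sdiff.1 ((h4 x).2 ⟨v, hv⟩)).1

/-- Supplies the increasing chains from which hard inputs are built; the infinity of the domain is
used only here. -/
theorem exists_strictMonoOn_Iio (α : Type v) [LinearOrder α] [Infinite α] (k : ℕ) :
    ∃ e : ℕ → α, StrictMonoOn e (Set.Iio k) := by
  obtain ⟨s, hs⟩ := Infinite.exists_subset_card_eq α k
  obtain ⟨x⟩ : Nonempty α := inferInstance
  refine ⟨fun i => if h : i < k then s.orderEmbOfFin hs ⟨i, h⟩ else x, fun i hi j hj hij => ?_⟩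
  rw [Set.mem_Iio] at hi hj
  simpa [hi, hj] using hij

/-! ### Data crossing an edge -/

namespace TreeNetwork

variable {V : Type u} (net : TreeNetwork V) {α : Type v} [LinearOrder α]
  (A : Algorithm net.Node α) (ω : A.Seed) {D : net.Node → Finset α} {a b : V}

/-- All the elements that are routed through an edge, in either direction. -/
noncomputable def crossing (D : net.Node → Finset α) (a b : V) : Finset α :=
  (Finset.range A.rounds).biUnion fun i => net.linkData A ω D i a b ∪ net.linkData A ω D i b a

theorem crossing_comm : net.crossing A ω D a b = net.crossing A ω D b a := by
  unfold crossing
  simp_rw [Finset.union_comm]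

/-- The factor 2 appears because a round is charged for the maximum over directed links, while both
directions are counted here. -/
theorem card_crossing_div_le (hab : net.graph.Adj a b) :
    ((net.crossing A ω D a b).card : ℝ≥0∞) / net.bandwidth a b ≤ 2 * net.cost A ω D := by
  have hround : ∀ {a b : V} (_ : net.graph.Adj a b) (i : ℕ),
      ((net.linkData A ω D i a b).card : ℝ≥0∞) / net.bandwidth a b ≤ net.roundCost A ω D i :=
    fun {a b} h i => le_iSup_of_le a (le_iSup_of_le b (le_iSup_of_le h le_rfl))
  have hcard : ((net.crossing A ω D a b).card : ℝ≥0∞) ≤ ∑ i ∈ Finset.range A.rounds,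
      (((net.linkData A ω D i a b).card : ℝ≥0∞) + (net.linkData A ω D i b a).card) := by
    have h : (net.crossing A ω D a b).card ≤ ∑ i ∈ Finset.range A.rounds,
        ((net.linkData A ω D i a b).card + (net.linkData A ω D i b a).card) :=
      Finset.card_biUnion_le.trans (Finset.sum_le_sum fun i _ => Finset.card_union_le _ _)
    exact_mod_cast h
  calc _ ≤ (∑ i ∈ Finset.range A.rounds, (((net.linkData A ω D i a b).card : ℝ≥0∞) +
        (net.linkData A ω D i b a).card)) / net.bandwidth a b := ENNReal.div_le_div_right hcard _
    _ = ∑ i ∈ Finset.range A.rounds, (((net.linkData A ω D i a b).card : ℝ≥0∞) /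
          net.bandwidth a b + (net.linkData A ω D i b a).card / net.bandwidth b a) := by
        rw [net.bandwidth_symm b a hab.symm, div_eq_mul_inv, Finset.sum_mul]
        simp_rw [add_mul, div_eq_mul_inv]
    _ ≤ ∑ i ∈ Finset.range A.rounds, 2 * net.roundCost A ω D i :=
        Finset.sum_le_sum fun i _ => by
          rw [two_mul]
          exact add_le_add (hround hab i) (hround hab.symm i)
    _ = _ := by rw [← Finset.mul_sum]; rfl

theorem message_subset_crossing (hab : net.graph.Adj a b) {i : ℕ} (hi : i < A.rounds)
    {s t : net.Node} (hs : s ∈ net.side a b) (ht : t ∈ net.side b a) :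
    A.message ω D i s t ⊆ net.crossing A ω D a b := by
  intro x hx
  refine Finset.mem_biUnion.2 ⟨i, Finset.mem_range.2 hi, Finset.mem_union_left _ ?_⟩
  rw [linkData_eq net A ω D i hab]
  exact Finset.mem_biUnion.2 ⟨s, hs, Finset.mem_biUnion.2 ⟨t, ht, hx⟩⟩

/-- What a node knows has been on its side of an edge from the beginning, unless it has crossed the
edge. -/
theorem mem_or_mem_crossing_of_held (hab : net.graph.Adj a b) {x : α} :
    ∀ i ≤ A.rounds, ∀ s ∈ net.side a b, Held (D s) (A.history ω D i s) x →
      (∃ w ∈ net.side a b, x ∈ D w) ∨ x ∈ net.crossing A ω D a b := by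
  intro i
  induction i with
  | zero =>
    rintro - s hs (h | ⟨r, hr, -⟩)
    · exact Or.inl ⟨s, hs, h⟩
    · simp [Algorithm.history] at hr
  | succ i ih =>
    rintro hi s hs (h | ⟨r, hr, w, hw⟩)
    · exact Or.inl ⟨s, hs, h⟩
    · rw [Algorithm.history, List.mem_append, List.mem_singleton] at hr
      rcases hr with hr | rfl
      · exact ih (by omega) s hs (Or.inr ⟨r, hr, w, hw⟩)
      · by_cases hwa : w ∈ net.side a b
        · exact ih (by omega) w hwa (A.send_held _ _ _ _ _ _ hw)
        · rw [← net.mem_side_swap_iff hab] at hwa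
          right
          rw [crossing_comm]
          exact message_subset_crossing net A ω hab.symm (by omega) hwa hs hw

theorem mem_or_mem_crossing_of_mem_result (hab : net.graph.Adj a b) {x : α} {s : net.Node}
    (hs : s ∈ net.side a b) (hx : x ∈ A.result ω D s) :
    (∃ w ∈ net.side a b, x ∈ D w) ∨ x ∈ net.crossing A ω D a b :=
  net.mem_or_mem_crossing_of_held A ω hab A.rounds le_rfl s hs (A.output_held _ _ _ _ _ hx)

/-- Without communication over an edge, one side learns nothing about the other one. -/
theorem history_eq_of_crossing_eq_empty (hab : net.graph.Adj a b) {D' : net.Node → Finset α}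
    (hD : ∀ w ∈ net.side a b, D w = D' w) (h : net.crossing A ω D a b = ∅)
    (h' : net.crossing A ω D' a b = ∅) :
    ∀ i ≤ A.rounds, ∀ s ∈ net.side a b, A.history ω D i s = A.history ω D' i s := by
  intro i
  induction i with
  | zero => intros; rfl
  | succ i ih =>
    intro hi s hs
    rw [Algorithm.history, Algorithm.history, ih (by omega) s hs]
    congr 2
    funext w
    by_cases hw : w ∈ net.side a b
    · rw [ih (by omega) w hw, hD w hw]
    · rw [← net.mem_side_swap_iff hab] at hw
      have h1 := message_subset_crossing net A ω (D := D) hab.symm (show i < A.rounds by omega)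
        hw hs
      have h2 := message_subset_crossing net A ω (D := D') hab.symm (show i < A.rounds by omega)
        hw hs
      rw [crossing_comm, h, Finset.subset_empty] at h1
      rw [crossing_comm, h', Finset.subset_empty] at h2
      exact h1.trans h2.symm

theorem result_eq_of_crossing_eq_empty (hab : net.graph.Adj a b) {D' : net.Node → Finset α}
    (hD : ∀ w ∈ net.side a b, D w = D' w) (h : net.crossing A ω D a b = ∅)
    (h' : net.crossing A ω D' a b = ∅) {s : net.Node} (hs : s ∈ net.side a b) :
    A.result ω D s = A.result ω D' s := by
  rw [Algorithm.result, Algorithm.result, hD s hs,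
    net.history_eq_of_crossing_eq_empty A ω hab hD h h' _ le_rfl s hs]

variable {n : net.Node → ℕ}

/-- A placement with prescribed data on the two sides of an edge. -/
theorem isPlacement_union (hab : net.graph.Adj a b) {S T : Finset α} (hST : Disjoint S T)
    {F G : net.Node → Finset α}
    (hF : (∀ w ∈ net.side a b, (F w).card = n w) ∧ (∀ w, w ∉ net.side a b → F w = ∅) ∧
      (Pairwise fun a b => Disjoint (F a) (F b)) ∧ ∀ x, x ∈ S ↔ ∃ w, x ∈ F w)
    (hG : (∀ w ∈ net.side b a, (G w).card = n w) ∧ (∀ w, w ∉ net.side b a → G w = ∅) ∧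
      (Pairwise fun a b => Disjoint (G a) (G b)) ∧ ∀ x, x ∈ T ↔ ∃ w, x ∈ G w) :
    IsPlacement (S ∪ T) n (fun w => F w ∪ G w) := by
  obtain ⟨hF1, hF2, hF3, hF4⟩ := hF
  obtain ⟨hG1, hG2, hG3, hG4⟩ := hG
  have hFG : ∀ v w, Disjoint (F v) (G w) := fun v w =>
    hST.mono (fun x hx => (hF4 x).2 ⟨v, hx⟩) (fun x hx => (hG4 x).2 ⟨w, hx⟩)
  refine ⟨fun c d hcd => ?_, fun x => ?_, fun w => ?_⟩
  · change Disjoint (F c ∪ G c) (F d ∪ G d)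
    rw [Finset.disjoint_union_left, Finset.disjoint_union_right, Finset.disjoint_union_right]
    exact ⟨⟨hF3 hcd, hFG c d⟩, (hFG d c).symm, hG3 hcd⟩
  · simp only [Finset.mem_union, hF4, hG4, exists_or]
  · by_cases hw : w ∈ net.side a b
    · rw [hG2 w (by rw [net.mem_side_swap_iff hab]; simpa using hw), Finset.union_empty,
        hF1 w hw]
    · rw [hF2 w hw, Finset.empty_union, hG1 w ((net.mem_side_swap_iff hab w).2 hw)]

theorem sum_side_add_sum_side (hab : net.graph.Adj a b) (n : net.Node → ℕ) :
    ∑ w ∈ net.side a b, n w + ∑ w ∈ net.side b a, n w = ∑ w, n w := by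
  classical
  have h : net.side b a = (net.side a b)ᶜ := by
    ext w
    rw [Finset.mem_compl, net.mem_side_swap_iff hab]
  rw [h, Finset.sum_add_sum_compl]

variable {A} {K : ℝ≥0∞} {root : V} {order : List net.Node}

omit ω in
/-- If both sides of an edge hold data, then some data must cross the edge. -/
theorem one_div_bandwidth_le [Infinite α] (ho : net.IsTraversal root order)
    (hA : ∀ (R : Finset α) (D : net.Node → Finset α), IsPlacement R n D →
      net.SortsWithCost A order D K (1 - 1 / ((∑ w, n w : ℕ) : ℝ≥0∞)))
    (hab : net.graph.Adj a b) (hr : (net.graph.deleteEdges {s(a, b)}).Reachable a root)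
    (hN : 3 ≤ ∑ w, n w) (ha : 0 < ∑ w ∈ net.side a b, n w) (hb : 0 < ∑ w ∈ net.side b a, n w) :
    1 / net.bandwidth a b ≤ 2 * K := by
  classical
  set nA := ∑ w ∈ net.side a b, n w
  set nB := ∑ w ∈ net.side b a, n w
  -- A chain in three blocks `T₁ < S < T₂`. The side of `a` always holds `S`; the side of `b` holds
  -- `T₁` in one input and `T₂` in the other.
  obtain ⟨e, he⟩ := exists_strictMonoOn_Iio α (nB + nA + nB)
  have hcard : ∀ p q : ℕ, p ≤ q → q ≤ nB + nA + nB → ((Finset.Ico p q).image e).card = q - p := by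
    intro p q _ hq
    rw [Finset.card_image_of_injOn, Nat.card_Ico]
    refine he.injOn.mono fun i hi => ?_
    have := (Finset.mem_Ico.1 (Finset.mem_coe.1 hi)).2
    exact Set.mem_Iio.2 (by omega)
  have hlt : ∀ p q r t : ℕ, q ≤ r → t ≤ nB + nA + nB → ∀ x ∈ (Finset.Ico p q).image e,
      ∀ y ∈ (Finset.Ico r t).image e, x < y := by
    intro p q r t hqr ht x hx y hy
    obtain ⟨i, hi, rfl⟩ := Finset.mem_image.1 hx
    obtain ⟨j, hj, rfl⟩ := Finset.mem_image.1 hy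
    rw [Finset.mem_Ico] at hi hj
    exact he (Set.mem_Iio.2 (by omega)) (Set.mem_Iio.2 (by omega)) (by omega)
  set S := (Finset.Ico nB (nB + nA)).image e with hS
  set T₁ := (Finset.Ico 0 nB).image e with hT₁
  set T₂ := (Finset.Ico (nB + nA) (nB + nA + nB)).image e with hT₂
  have hlt₁ : ∀ x ∈ T₁, ∀ y ∈ S, x < y := hlt _ _ _ _ le_rfl (by omega)
  have hlt₂ : ∀ x ∈ S, ∀ y ∈ T₂, x < y := hlt _ _ _ _ le_rfl le_rfl
  have hSc : S.card = nA := by rw [hS, hcard] <;> omega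
  have hT₁c : T₁.card = nB := by rw [hT₁, hcard] <;> omega
  have hT₂c : T₂.card = nB := by rw [hT₂, hcard] <;> omega
  obtain ⟨F, hF⟩ := exists_division n (net.side a b) S hSc
  obtain ⟨G₁, hG₁⟩ := exists_division n (net.side b a) T₁ hT₁c
  obtain ⟨G₂, hG₂⟩ := exists_division n (net.side b a) T₂ hT₂c
  have hP₁ := net.isPlacement_union hab
    (Finset.disjoint_left.2 fun x hx hy => lt_irrefl x (hlt₁ x hy x hx)) hF hG₁
  have hP₂ := net.isPlacement_union hab
    (Finset.disjoint_left.2 fun x hx hy => lt_irrefl x (hlt₂ x hx x hy)) hF hG₂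
  obtain ⟨E₁, hE₁, hp₁, hs₁⟩ := hA _ _ hP₁
  obtain ⟨E₂, hE₂, hp₂, hs₂⟩ := hA _ _ hP₂
  -- The failure probabilities add up to at most 2/N < 1, so some seed succeeds on both inputs.
  obtain ⟨ω, hω₁, hω₂⟩ : (E₁ ∩ E₂).Nonempty := by
    by_contra hne
    rw [Set.not_nonempty_iff_eq_empty] at hne
    have h1 : A.law E₁ᶜ ≤ 1 / ((∑ w, n w : ℕ) : ℝ≥0∞) := by
      rw [prob_compl_eq_one_sub hE₁]
      exact tsub_le_iff_tsub_le.1 hp₁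
    have h2 : A.law E₂ᶜ ≤ 1 / ((∑ w, n w : ℕ) : ℝ≥0∞) := by
      rw [prob_compl_eq_one_sub hE₂]
      exact tsub_le_iff_tsub_le.1 hp₂
    have h3 : (1 : ℝ≥0∞) ≤ 2 / ((∑ w, n w : ℕ) : ℝ≥0∞) := by
      calc (1 : ℝ≥0∞) = A.law (E₁ᶜ ∪ E₂ᶜ) := by
            rw [← Set.compl_inter, hne, Set.compl_empty, measure_univ]
        _ ≤ _ := (measure_union_le _ _).trans (add_le_add h1 h2)
        _ = _ := by rw [ENNReal.div_add_div_same, one_add_one_eq_two]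
    have h4 : ((∑ w, n w : ℕ) : ℝ≥0∞) ≠ 0 := by
      rw [Nat.cast_ne_zero]; omega
    rw [ENNReal.le_div_iff_mul_le (Or.inl h4) (Or.inl (ENNReal.natCast_ne_top _)), one_mul] at h3
    have h5 : ∑ w, n w ≤ 2 := by exact_mod_cast h3
    omega
  have hend : ∀ D : net.Node → Finset α, (net.crossing A ω D a b).Nonempty →
      net.cost A ω D ≤ K → 1 / net.bandwidth a b ≤ 2 * K := by
    intro D hne hK
    calc 1 / net.bandwidth a b ≤ ((net.crossing A ω D a b).card : ℝ≥0∞) / net.bandwidth a b :=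
          ENNReal.div_le_div_right (by exact_mod_cast Finset.card_pos.2 hne) _
      _ ≤ 2 * net.cost A ω D := net.card_crossing_div_le A ω hab
      _ ≤ 2 * K := by gcongr
  obtain ⟨hsort₁, hcost₁⟩ := hs₁ ω hω₁
  obtain ⟨hsort₂, hcost₂⟩ := hs₂ ω hω₂
  rcases Finset.eq_empty_or_nonempty (net.crossing A ω (fun w => F w ∪ G₁ w) a b) with h₁ | h₁
  swap
  · exact hend _ h₁ hcost₁
  rcases Finset.eq_empty_or_nonempty (net.crossing A ω (fun w => F w ∪ G₂ w) a b) with h₂ | h₂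
  swap
  · exact hend _ h₂ hcost₂
  exfalso
  obtain ⟨l₁, l₂, l₃, rfl, hl₁, hl₂, hl₃⟩ := ho.exists_split net hab hr
  have hmem : ∀ {G : net.Node → Finset α} {T : Finset α},
      IsSorted (l₁ ++ l₂ ++ l₃) (fun w => F w ∪ G w) (A.result ω fun w => F w ∪ G w) →
      (∀ w, w ∉ net.side b a → G w = ∅) → (∀ x, x ∈ T ↔ ∃ w, x ∈ G w) → Disjoint S T →
      net.crossing A ω (fun w => F w ∪ G w) a b = ∅ → ∀ y ∈ T,
      ∃ t ∈ l₂, y ∈ A.result ω (fun w => F w ∪ G w) t := by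
    intro G T hsort hG hT hST hcr y hy
    obtain ⟨w, hw⟩ := (hT y).1 hy
    obtain ⟨t, ht, hyt⟩ := List.mem_flatMap.1 ((hsort.2 y).2 ⟨w, Finset.mem_union_right _ hw⟩)
    have hta : t ∉ net.side a b := by
      intro hta
      rcases net.mem_or_mem_crossing_of_mem_result A ω hab hta hyt with ⟨v, hv, hyv⟩ | h
      · rcases Finset.mem_union.1 hyv with h | h
        · exact Finset.disjoint_left.1 hST ((hF.2.2.2 y).2 ⟨v, h⟩) hy
        · rw [hG v (by rw [net.mem_side_swap_iff hab]; simpa using hv)] at h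
          simp at h
      · rw [hcr] at h
        simp at h
    rw [List.mem_append, List.mem_append] at ht
    rcases ht with (ht | ht) | ht
    · exact absurd (hl₁ t ht) hta
    · exact ⟨t, ht, hyt⟩
    · exact absurd (hl₃ t ht) hta
  obtain ⟨x, hx⟩ : S.Nonempty := Finset.card_pos.1 (by omega)
  obtain ⟨y₁, hy₁⟩ : T₁.Nonempty := Finset.card_pos.1 (by omega)
  obtain ⟨y₂, hy₂⟩ : T₂.Nonempty := Finset.card_pos.1 (by omega)
  obtain ⟨t₁, ht₁, hyt₁⟩ := hmem hsort₁ hG₁.2.1 hG₁.2.2.2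
    (Finset.disjoint_left.2 fun x hx hy => lt_irrefl x (hlt₁ x hy x hx)) h₁ y₁ hy₁
  obtain ⟨t₂, ht₂, hyt₂⟩ := hmem hsort₂ hG₂.2.1 hG₂.2.2.2
    (Finset.disjoint_left.2 fun x hx hy => lt_irrefl x (hlt₂ x hx x hy)) h₂ y₂ hy₂
  obtain ⟨w, hw⟩ := (hF.2.2.2 x).1 hx
  obtain ⟨s, hs, hxs⟩ := List.mem_flatMap.1 ((hsort₁.2 x).2 ⟨w, Finset.mem_union_left _ hw⟩)
  have hsa : s ∈ net.side a b := by
    by_contra hsb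
    rw [← net.mem_side_swap_iff hab] at hsb
    rcases net.mem_or_mem_crossing_of_mem_result A ω hab.symm hsb hxs with ⟨v, hv, hyv⟩ | h
    · rcases Finset.mem_union.1 hyv with h | h
      · rw [net.mem_side_swap_iff hab] at hv
        rw [hF.2.1 v hv] at h
        simp at h
      · exact lt_irrefl x (hlt₁ x ((hG₁.2.2.2 x).2 ⟨v, h⟩) x hx)
    · rw [crossing_comm, h₁] at h
      simp at h
  -- The node `s` sees the same in both runs, hence returns `x` in both. The `b`-side nodes `l₂`
  -- return smaller elements in the first run, which rules out `s ∈ l₁`, and larger ones in the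
  -- second, which rules out `s ∈ l₃`.
  have hres := net.result_eq_of_crossing_eq_empty A ω hab (D := fun w => F w ∪ G₁ w)
    (D' := fun w => F w ∪ G₂ w) (fun w hw => by
      have hw' : w ∉ net.side b a := by rw [net.mem_side_swap_iff hab]; simpa using hw
      simp [hG₁.2.1 w hw', hG₂.2.1 w hw']) h₁ h₂ hsa
  rw [List.mem_append, List.mem_append] at hs
  rcases hs with (hs | hs) | hs
  · have hsort₁' := hsort₁
    rw [List.append_assoc] at hsort₁'
    exact lt_asymm (hsort₁'.lt_of_append hs (List.mem_append_left _ ht₁) hxs hyt₁)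
      (hlt₁ y₁ hy₁ x hx)
  · exact ((net.mem_side_swap_iff hab s).1 (hl₂ s hs)) hsa
  · rw [hres] at hxs
    exact lt_asymm (hsort₂.lt_of_append (List.mem_append_right _ ht₂) hs hyt₂ hxs)
      (hlt₂ x hx y₂ hy₂)

variable {V : Type u} (net : TreeNetwork V) {α : Type v} [LinearOrder α]
  {A : Algorithm net.Node α} {a b : V} {n : net.Node → ℕ} {K : ℝ≥0∞} {root : V}
  {order : List net.Node}

/-- If the data of the two sides of an edge alternate, then almost all the data of the smaller side
cross the edge. -/
theorem le_card_crossing_add_one (ho : net.IsTraversal root order) {D : net.Node → Finset α}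
    (hab : net.graph.Adj a b) (hr : (net.graph.deleteEdges {s(a, b)}).Reachable a root)
    {ω : A.Seed} (hsort : IsSorted order D (A.result ω D)) (hdis : Pairwise fun a b =>
      Disjoint (D a) (D b)) {m : ℕ} {e : ℕ → α} (he : StrictMonoOn e (Set.Iio (2 * m)))
    (heven : ∀ i < m, ∃ w ∈ net.side b a, e (2 * i) ∈ D w)
    (hodd : ∀ i < m, ∃ w ∈ net.side a b, e (2 * i + 1) ∈ D w) :
    m ≤ (net.crossing A ω D a b).card + 1 := by
  classical
  obtain ⟨l₁, l₂, l₃, rfl, hl₁, hl₂, hl₃⟩ := ho.exists_split net hab hr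
  have hside : ∀ {x : α} {v w : net.Node}, v ∈ net.side a b → x ∈ D v → w ∈ net.side b a →
      x ∈ D w → False := by
    intro x v w hv hx hw hx'
    rw [net.mem_side_swap_iff hab] at hw
    have hvw : v ≠ w := by rintro rfl; exact hw hv
    exact Finset.disjoint_left.1 (hdis hvw) hx hx'
  have hcross_even : ∀ i < m, e (2 * i) ∉ net.crossing A ω D a b →
      ∃ t ∈ l₂, e (2 * i) ∈ A.result ω D t := by
    intro i hi hc
    obtain ⟨w, hw, hx⟩ := heven i hi
    obtain ⟨t, ht, hxt⟩ := List.mem_flatMap.1 ((hsort.2 _).2 ⟨w, hx⟩)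
    have hta : t ∉ net.side a b := fun hta =>
      (net.mem_or_mem_crossing_of_mem_result A ω hab hta hxt).elim
        (fun ⟨v, hv, hxv⟩ => hside hv hxv hw hx) hc
    rw [List.mem_append, List.mem_append] at ht
    rcases ht with (ht | ht) | ht
    · exact absurd (hl₁ t ht) hta
    · exact ⟨t, ht, hxt⟩
    · exact absurd (hl₃ t ht) hta
  have hcross_odd : ∀ i < m, e (2 * i + 1) ∉ net.crossing A ω D a b →
      ∃ t, (t ∈ l₁ ∨ t ∈ l₃) ∧ e (2 * i + 1) ∈ A.result ω D t := by
    intro i hi hc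
    obtain ⟨w, hw, hx⟩ := hodd i hi
    obtain ⟨t, ht, hxt⟩ := List.mem_flatMap.1 ((hsort.2 _).2 ⟨w, hx⟩)
    have htb : t ∉ net.side b a := fun htb =>
      (net.mem_or_mem_crossing_of_mem_result A ω hab.symm htb hxt).elim
        (fun ⟨v, hv, hxv⟩ => hside hw hx hv hxv) (by rwa [crossing_comm])
    rw [List.mem_append, List.mem_append] at ht
    rcases ht with (ht | ht) | ht
    · exact ⟨t, Or.inl ht, hxt⟩
    · exact absurd (hl₂ t ht) htb
    · exact ⟨t, Or.inr ht, hxt⟩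
  -- The pairs (e(2i), e(2i+1)) of which an element crosses; the pairs are disjoint, so there are no
  -- more of them than crossing elements.
  set G := (Finset.range m).filter fun i => e (2 * i) ∈ net.crossing A ω D a b ∨
    e (2 * i + 1) ∈ net.crossing A ω D a b with hG
  have hGcard : G.card ≤ (net.crossing A ω D a b).card := by
    refine Finset.card_le_card_of_forall_subsingleton
      (fun i x => x = e (2 * i) ∨ x = e (2 * i + 1)) ?_ ?_
    · intro i hi
      obtain ⟨-, h | h⟩ := Finset.mem_filter.1 hi
      · exact ⟨_, h, Or.inl rfl⟩
      · exact ⟨_, h, Or.inr rfl⟩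
    · rintro x - i ⟨hi, hix⟩ j ⟨hj, hjx⟩
      have hi := Finset.mem_range.1 (Finset.mem_filter.1 hi).1
      have hj := Finset.mem_range.1 (Finset.mem_filter.1 hj).1
      have hinj : ∀ p q : ℕ, p < 2 * m → q < 2 * m → e p = e q → p = q :=
        fun p q hp hq h => he.injOn hp hq h
      rcases hix with rfl | rfl <;> rcases hjx with h | h <;>
        have := hinj _ _ (by omega) (by omega) h <;> omega
  have hrest : (Finset.range m \ G).card ≤ 1 := by
    -- For two uncrossed pairs i < j, the elements e(2i) < e(2i+1) < e(2j) would be returned inside,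
    -- outside and inside the block `l₂`.
    have key : ∀ i ∈ Finset.range m \ G, ∀ j ∈ Finset.range m \ G, ¬ i < j := by
      intro i hi j hj hij
      simp only [hG, Finset.mem_sdiff, Finset.mem_filter, Finset.mem_range, not_and, not_or]
        at hi hj
      obtain ⟨s, hs, hxs⟩ := hcross_even i hi.1 (hi.2 hi.1).1
      obtain ⟨t, ht, hxt⟩ := hcross_even j hj.1 (hj.2 hj.1).1
      obtain ⟨v, hv | hv, hxv⟩ := hcross_odd i hi.1 (hi.2 hi.1).2
      · rw [List.append_assoc] at hsort
        exact lt_asymm (hsort.lt_of_append hv (List.mem_append_left _ hs) hxv hxs)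
          (he (Set.mem_Iio.2 (by omega)) (Set.mem_Iio.2 (by omega)) (by omega))
      · exact lt_asymm (hsort.lt_of_append (List.mem_append_right _ ht) hv hxt hxv)
          (he (Set.mem_Iio.2 (by omega)) (Set.mem_Iio.2 (by omega)) (by omega))
    exact Finset.card_le_one.2 fun i hi j hj =>
      le_antisymm (not_lt.1 (key j hj i hi)) (not_lt.1 (key i hi j hj))
  have h : (Finset.range m \ G).card + G.card = (Finset.range m).card :=
    Finset.card_sdiff_add_card_eq_card (Finset.filter_subset _ _)
  rw [Finset.card_range] at h
  omega

/-- Applies the alternation argument to an input whose first 2m elements alternate between the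
sides. -/
theorem sub_one_div_bandwidth_le [Infinite α] (ho : net.IsTraversal root order)
    (hA : ∀ (R : Finset α) (D : net.Node → Finset α), IsPlacement R n D →
      net.SortsWithCost A order D K (1 - 1 / ((∑ w, n w : ℕ) : ℝ≥0∞)))
    (hab : net.graph.Adj a b) (hr : (net.graph.deleteEdges {s(a, b)}).Reachable a root)
    (hN : 2 ≤ ∑ w, n w) :
    ((min (∑ w ∈ net.side a b, n w) (∑ w ∈ net.side b a, n w) - 1 : ℕ) : ℝ≥0∞) /
      net.bandwidth a b ≤ 2 * K := by
  classical
  have hsum := net.sum_side_add_sum_side hab n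
  set nA := ∑ w ∈ net.side a b, n w
  set nB := ∑ w ∈ net.side b a, n w
  set m := min nA nB with hm
  obtain ⟨e, he⟩ := exists_strictMonoOn_Iio α (nA + nB)
  -- The smaller side gets exactly the positions of its parity below 2m, the larger side all the
  -- others.
  obtain ⟨I, J, hIc, hJc, hIJ, hIn, hJn, hIodd, hJeven⟩ : ∃ I J : Finset ℕ, I.card = nA ∧
      J.card = nB ∧ Disjoint I J ∧ (∀ i ∈ I, i < nA + nB) ∧ (∀ i ∈ J, i < nA + nB) ∧
      (∀ i < m, 2 * i + 1 ∈ I) ∧ ∀ i < m, 2 * i ∈ J := by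
    rcases le_total nA nB with h | h
    · have hm' : m = nA := min_eq_left h
      have hsub : (Finset.range m).image (fun i => 2 * i + 1) ⊆ Finset.range (nA + nB) := by
        intro i hi
        obtain ⟨j, hj, rfl⟩ := Finset.mem_image.1 hi
        rw [Finset.mem_range] at hj ⊢
        omega
      have hc : ((Finset.range m).image (fun i => 2 * i + 1)).card = nA := by
        rw [Finset.card_image_of_injective _ (fun i j h => by omega),
          Finset.card_range, hm']
      refine ⟨_, Finset.range (nA + nB) \ (Finset.range m).image (fun i => 2 * i + 1), hc, ?_,
        Finset.disjoint_sdiff, fun i hi => Finset.mem_range.1 (hsub hi),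
        fun i hi => Finset.mem_range.1 (Finset.mem_sdiff.1 hi).1,
        fun i hi => Finset.mem_image_of_mem _ (Finset.mem_range.2 hi), fun i hi => ?_⟩
      · rw [Finset.card_sdiff_of_subset hsub, hc, Finset.card_range]
        omega
      · simp only [Finset.mem_sdiff, Finset.mem_range, Finset.mem_image, not_exists, not_and]
        exact ⟨by omega, fun j _ => by omega⟩
    · have hm' : m = nB := min_eq_right h
      have hsub : (Finset.range m).image (fun i => 2 * i) ⊆ Finset.range (nA + nB) := by
        intro i hi
        obtain ⟨j, hj, rfl⟩ := Finset.mem_image.1 hi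
        rw [Finset.mem_range] at hj ⊢
        omega
      have hc : ((Finset.range m).image (fun i => 2 * i)).card = nB := by
        rw [Finset.card_image_of_injective _ (fun i j h => by omega),
          Finset.card_range, hm']
      refine ⟨Finset.range (nA + nB) \ (Finset.range m).image (fun i => 2 * i), _, ?_, hc,
        Finset.sdiff_disjoint, fun i hi => Finset.mem_range.1 (Finset.mem_sdiff.1 hi).1,
        fun i hi => Finset.mem_range.1 (hsub hi), fun i hi => ?_,
        fun i hi => Finset.mem_image_of_mem _ (Finset.mem_range.2 hi)⟩
      · rw [Finset.card_sdiff_of_subset hsub, hc, Finset.card_range]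
        omega
      · simp only [Finset.mem_sdiff, Finset.mem_range, Finset.mem_image, not_exists, not_and]
        exact ⟨by omega, fun j _ => by omega⟩
  have heI : Set.InjOn e I := he.injOn.mono fun i hi => hIn i hi
  have heJ : Set.InjOn e J := he.injOn.mono fun i hi => hJn i hi
  obtain ⟨F, hF⟩ := exists_division n (net.side a b) (I.image e)
    (by rw [Finset.card_image_of_injOn heI, hIc])
  obtain ⟨G, hG⟩ := exists_division n (net.side b a) (J.image e)
    (by rw [Finset.card_image_of_injOn heJ, hJc])
  have hdis : Disjoint (I.image e) (J.image e) := by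
    rw [Finset.disjoint_left]
    intro x hx hy
    obtain ⟨i, hi, rfl⟩ := Finset.mem_image.1 hx
    obtain ⟨j, hj, hij⟩ := Finset.mem_image.1 hy
    obtain rfl := he.injOn (hJn j hj) (hIn i hi) hij
    exact Finset.disjoint_left.1 hIJ hi hj
  have hP := net.isPlacement_union hab hdis hF hG
  obtain ⟨E, -, hp, hs⟩ := hA _ _ hP
  -- For N ≥ 2 the success probability is positive, and one successful run is enough.
  obtain ⟨ω, hω⟩ : E.Nonempty := by
    by_contra hne
    rw [Set.not_nonempty_iff_eq_empty] at hne
    rw [hne, measure_empty, nonpos_iff_eq_zero, tsub_eq_zero_iff_le, one_div,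
      ENNReal.one_le_inv] at hp
    have : ∑ w, n w ≤ 1 := by exact_mod_cast hp
    omega
  obtain ⟨hsort, hcost⟩ := hs ω hω
  have hle := net.le_card_crossing_add_one ho hab hr hsort hP.disjoint (m := m) (e := e)
    (he.mono (Set.Iio_subset_Iio (by omega))) (fun i hi => ?_) (fun i hi => ?_)
  · calc ((m - 1 : ℕ) : ℝ≥0∞) / net.bandwidth a b
        ≤ ((net.crossing A ω (fun w => F w ∪ G w) a b).card : ℝ≥0∞) / net.bandwidth a b :=
          ENNReal.div_le_div_right (by exact_mod_cast Nat.sub_le_iff_le_add.2 hle) _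
      _ ≤ 2 * net.cost A ω fun w => F w ∪ G w := net.card_crossing_div_le A ω hab
      _ ≤ 2 * K := by gcongr
  · obtain ⟨w, hw⟩ := (hG.2.2.2 (e (2 * i))).1 (Finset.mem_image_of_mem e (hJeven i hi))
    refine ⟨w, ?_, Finset.mem_union_right _ hw⟩
    by_contra hwb
    simp [hG.2.1 w hwb] at hw
  · obtain ⟨w, hw⟩ := (hF.2.2.2 (e (2 * i + 1))).1 (Finset.mem_image_of_mem e (hIodd i hi))
    refine ⟨w, ?_, Finset.mem_union_left _ hw⟩
    by_contra hwb
    simp [hF.2.1 w hwb] at hw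

/-- No algorithm sorts at a cost much below the lower bound. -/
theorem lowerBound_le [Infinite α] (hN : 3 ≤ ∑ w, n w) :
    net.lowerBound n ≤ 4 * net.optimalCost α n := by
  have hmain : ∀ (K : ℝ≥0∞) (A : Algorithm net.Node α) (root : V) (order : List net.Node),
      net.IsTraversal root order →
      (∀ (R : Finset α) (D : net.Node → Finset α), IsPlacement R n D →
        net.SortsWithCost A order D K (1 - 1 / ((∑ w, n w : ℕ) : ℝ≥0∞))) →
      ∀ a b : V, net.graph.Adj a b → (net.graph.deleteEdges {s(a, b)}).Reachable a root →
      ((min (∑ w ∈ net.side a b, n w) (∑ w ∈ net.side b a, n w) : ℕ) : ℝ≥0∞) /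
        net.bandwidth a b ≤ 4 * K := by
    intro K A root order ho hA a b hab hr
    rcases Nat.eq_zero_or_pos (min (∑ w ∈ net.side a b, n w) (∑ w ∈ net.side b a, n w)) with
      h0 | h0
    · simp [h0]
    · have h1 := net.one_div_bandwidth_le ho hA hab hr hN (lt_min_iff.1 h0).1 (lt_min_iff.1 h0).2
      have h2 := net.sub_one_div_bandwidth_le ho hA hab hr (by omega)
      -- Split m = (m - 1) + 1: alternation pays for the first summand, indistinguishability for the
      -- second.
      rw [← Nat.sub_add_cancel h0, Nat.cast_add, Nat.cast_one, ENNReal.add_div]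
      calc _ ≤ 2 * K + 2 * K := add_le_add h2 h1
        _ = 4 * K := by rw [← add_mul]; norm_num
  rw [mul_comm, ← ENNReal.div_le_iff_le_mul (Or.inl (by norm_num)) (Or.inl (by norm_num)),
    optimalCost]
  refine le_sInf ?_
  rintro K ⟨A, root, order, ho, hA⟩
  rw [ENNReal.div_le_iff_le_mul (Or.inl (by norm_num)) (Or.inl (by norm_num))]
  refine iSup_le fun a => iSup_le fun b => iSup_le fun hab => ?_
  -- The two sides play symmetric roles in the bound, so the end on the side of the root may be
  -- called `a`.
  rcases reachable_or_reachable (a := a) (b := b) net.isTree root with h | h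
  · exact (hmain K A root order ho hA a b hab h).trans_eq (mul_comm _ _)
  · rw [Sym2.eq_swap] at h
    rw [min_comm, net.bandwidth_symm a b hab]
    exact (hmain K A root order ho hA b a hab.symm h).trans_eq (mul_comm _ _)

end TreeNetwork

end TopologySort

/-! ### The main theorem -/

theorem mainTheorem6 :
    ∃ C : ℝ≥0,
      ∀ (V : Type u) [Fintype V] (net : TopologySort.TreeNetwork V)
        (root : V) (order : List net.Node) (_ : net.IsTraversal root order)
        (α : Type v) [LinearOrder α] (R : Finset α)
        (n : net.Node → ℕ) (D : net.Node → Finset α) (_ : TopologySort.IsPlacement R n D)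
        (_ : 4 * (net.compute.card : ℝ) ^ 2 * Real.log (net.compute.card * R.card) ≤ R.card),
        (TopologySort.weightedTeraSort n order α).rounds = 4 ∧
        net.SortsWithCost (TopologySort.weightedTeraSort n order α) order D
          (C * net.lowerBound n) (1 - 1 / (R.card : ℝ≥0∞)) ∧
        (Infinite α →
          net.SortsWithCost (TopologySort.weightedTeraSort n order α) order D
            (C * net.optimalCost α n) (1 - 1 / (R.card : ℝ≥0∞))) := by
  -- 2160 = 540 · 4: the cost in terms of C_LB times the loss between C_LB and the optimum.
  refine ⟨2160, fun V _ net root order ho α _ R n D hD hlog => ⟨rfl, ?_⟩⟩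
  rcases Nat.lt_or_ge R.card 2 with hR | hR
  · have hp : 1 - 1 / (R.card : ℝ≥0∞) ≤ 0 := by
      rw [nonpos_iff_eq_zero, tsub_eq_zero_iff_le, one_div, ENNReal.one_le_inv]
      exact_mod_cast (by omega : R.card ≤ 1)
    exact ⟨net.sortsWithCost_of_le hp, fun _ => net.sortsWithCost_of_le hp⟩
  · have h := net.weightedTeraSort_sortsWithCost ho hD hlog hR
    refine ⟨h.mono net ?_, fun _ => h.mono net ?_⟩
    · gcongr
      norm_num
    · have hc : 1 ≤ net.compute.card := by
        obtain ⟨x, hx⟩ := Finset.card_pos.1 (by omega : 0 < R.card)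
        obtain ⟨w, -⟩ := (hD.union x).1 hx
        exact Finset.card_pos.2 ⟨w, w.2⟩
      have hN : 3 ≤ ∑ w, n w := by
        have h3 := (TopologySort.WTS.size_bounds hc hR hlog).1
        rwa [TopologySort.WTS.card_eq_total hD] at h3
      calc 540 * net.lowerBound n ≤ 540 * (4 * net.optimalCost α n) := by
            gcongr
            exact net.lowerBound_le hN
        _ = _ := by
            rw [← mul_assoc]
            norm_num
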